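/- Let $a$ be the number of groups and $t_1,\dots,t_a$ fixed numbers of time points, $T=\sum_i t_i$. For $i=1,\dots,a$ and $k=1,2,\dots$ let $Y_{ik}$ be independent random vectors in $\mathbb{R}^{t_i}$ such that, for each $i$, the $Y_{ik}$ have a common distribution $F_i$ with $E\|Y_{i1}\|^4<\infty$, mean $\mu_i$ and positive definite covariance matrix $V_i$; put $\mu=(\mu_1',\dots,\mu_a')'\in\mathbb{R}^T$. Let $n_1,\dots,n_a$ be group sizes and $N=\sum_i n_i$. From the data $\mathbf Y=(Y_{ik})_{1\le i\le a,\,1\le k\le n_i}$ form $\overline Y_{i\cdot}=\frac1{n_i}\sum_{k}Y_{ik}$, $\overline Y_\cdot=(\overline Y_{1\cdot}',\dots,\overline Y_{a\cdot}')'$, $\widehat V_i=\frac1{n_i-1}\sum_{k}(Y_{ik}-\overline Y_{i\cdot})(Y_{ik}-\overline Y_{i\cdot})'$ and $\widehat\Sigma=N\bigoplus_{i=1}^a\frac1{n_i}\widehat V_i$. Let $H$ be a real matrix with $T$ columns whose rows sum to zero (a contrast matrix), and let $\mathbf T=H'(HH')^-H$, where $(\cdot)^-$ is any generalized inverse. With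 $(\cdot)^+$ the Moore–Penrose inverse, the Wald-type statistic (WTS) and the ANOVA-type statistic (ATS) are $$Q_N=N\,\overline Y_\cdot'H'(H\widehat\Sigma H')^+H\,\overline Y_\cdot,\qquad F_N=\frac{N}{\operatorname{tr}(\mathbf T\widehat\Sigma)}\,\overline Y_\cdot'\,\mathbf T\,\overline Y_\cdot$$ (a quotient with denominator $0$ is read as $0$). Given the data $\mathbf Y$, draw independent parametric bootstrap vectors $Y^\star_{ik}\sim N(0,\widehat V_i)$, $1\le k\le n_i$, $1\le i\le a$, and let $Q_N^\star$ and $F_N^\star$ be the statistics $Q_N$ and $F_N$ computed from the $Y^\star_{ik}$ in place of the $Y_{ik}$ (so that also $\widehat\Sigma$ is replaced by its bootstrap version). Assume $\min_i n_i\to\infty$ and $n_i/N\to\kappa_i>0$ for every $i$. Then the conditional distribution of $Q_N^\star$ given $\mathbf Y$ converges weakly, in probability, to the central $\chi^2_f$ distribution with $f=\operatorname{rank}(H)$; that is, $E(g(Q_N^\star)\mid\mathbf Y)\to\int g\,d\chi^2_f$ in probability for every bounded continuous $g:\mathbb{R}\to\mathbb{R}$. Moreover, let $\mu,\mu_0\in\mathbb{R}^T$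 with $H\mu_0=0$, let $P_\mu$ refer to the model above with mean vector $\mu$, and let $P_{\mu_0}$ refer to any model of the same kind with the same numbers $t_i$, sample sizes $n_i$ and covariance matrices $V_i$, but with mean vector $\mu_0$ (for instance the shifted data $Y_{ik}-\mu_i+\mu_{0,i}$). Then, in $P_\mu$-probability, $$\sup_{x\in\mathbb{R}}\bigl|P_\mu(Q_N^\star\le x\mid\mathbf Y)-P_{\mu_0}(Q_N\le x)\bigr|\to0\qquad\text{and}\qquad \sup_{x\in\mathbb{R}}\bigl|P_\mu(F_N^\star\le x\mid\mathbf Y)-P_{\mu_0}(F_N\le x)\bigr|\to0 .$$ -/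

import Mathlib

open MeasureTheory ProbabilityTheory Filter Topology Matrix
open scoped BoundedContinuousFunction

namespace ParamBoot

/-! ### Generalized inverses of real matrices -/

/-- `G` is a generalized inverse of `A`. -/
def IsGenInverse {m n : Type*} [Fintype m] [Fintype n]
    (A : Matrix m n ℝ) (G : Matrix n m ℝ) : Prop :=
  A * G * A = A

/-- The four Penrose equations: `B` is the Moore-Penrose inverse of the real matrix `A`. -/
structure IsMoorePenrose {m n : Type*} [Fintype m] [Fintype n]
    (A : Matrix m n ℝ) (B : Matrix n m ℝ) : Prop where
  mul_mul_left : A * B * A = A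
  mul_mul_right : B * A * B = B
  symm_left : (A * B)ᵀ = A * B
  symm_right : (B * A)ᵀ = B * A

theorem IsMoorePenrose.unique {m n : Type*} [Fintype m] [Fintype n]
    {A : Matrix m n ℝ} {B C : Matrix n m ℝ}
    (hB : IsMoorePenrose A B) (hC : IsMoorePenrose A C) : B = C := by
  have h1 : A * B = A * C := by
    have e : A * B = (A * C) * (A * B) := by
      conv_lhs => rw [← hC.mul_mul_left]
      simp only [Matrix.mul_assoc]
    calc A * B = (A * B)ᵀ := hB.symm_left.symm
      _ = ((A * C) * (A * B))ᵀ := by rw [← e]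
      _ = (A * B) * (A * C) := by rw [transpose_mul, hB.symm_left, hC.symm_left]
      _ = (A * B * A) * C := by simp only [Matrix.mul_assoc]
      _ = A * C := by rw [hB.mul_mul_left]
  have h2 : B * A = C * A := by
    have e : B * A = (B * A) * (C * A) := by
      conv_lhs => rw [← hC.mul_mul_left]
      simp only [Matrix.mul_assoc]
    calc B * A = (B * A)ᵀ := hB.symm_right.symm
      _ = ((B * A) * (C * A))ᵀ := by rw [← e]
      _ = (C * A) * (B * A) := by rw [transpose_mul, hB.symm_right, hC.symm_right]
      _ = C * (A * B * A) := by simp only [Matrix.mul_assoc]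
      _ = C * A := by rw [hB.mul_mul_left]
  calc B = B * A * B := hB.mul_mul_right.symm
    _ = C * (A * B) := by rw [h2, Matrix.mul_assoc]
    _ = C * A * C := by rw [h1, Matrix.mul_assoc]
    _ = C := hC.mul_mul_right

theorem exists_isMoorePenrose_of_isSymm {n : Type*} [Fintype n]
    (S : Matrix n n ℝ) (hS : Sᵀ = S) :
    ∃ P : Matrix n n ℝ, Pᵀ = P ∧ IsMoorePenrose S P := by
  classical
  have hH : S.IsHermitian := by
    rw [Matrix.IsHermitian, conjTranspose_eq_transpose_of_trivial, hS]
  obtain ⟨U, d, hU, hSd⟩ : ∃ (U : Matrix n n ℝ) (d : n → ℝ),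
      Uᵀ * U = 1 ∧ S = U * diagonal d * Uᵀ := by
    refine ⟨hH.eigenvectorUnitary, hH.eigenvalues, ?_, ?_⟩
    · have := Unitary.coe_star_mul_self hH.eigenvectorUnitary
      simpa [star_eq_conjTranspose, conjTranspose_eq_transpose_of_trivial] using this
    · have := hH.spectral_theorem
      simpa [Unitary.conjStarAlgAut_apply, star_eq_conjTranspose,
        conjTranspose_eq_transpose_of_trivial, Function.comp_def] using this
  have key : ∀ X Z : Matrix n n ℝ, (U * X * Uᵀ) * (U * Z * Uᵀ) = U * (X * Z) * Uᵀ := by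
    intro X Z
    calc (U * X * Uᵀ) * (U * Z * Uᵀ) = U * X * (Uᵀ * U) * Z * Uᵀ := by
          simp only [Matrix.mul_assoc]
      _ = U * (X * Z) * Uᵀ := by rw [hU]; simp only [Matrix.mul_assoc, Matrix.one_mul]
  have hsymm : ∀ e : n → ℝ, (U * diagonal e * Uᵀ)ᵀ = U * diagonal e * Uᵀ := by
    intro e
    simp only [transpose_mul, transpose_transpose, diagonal_transpose, Matrix.mul_assoc]
  have hd : ∀ i, d i * (d i)⁻¹ * d i = d i := fun i => mul_inv_mul_cancel (d i)
  have hd' : ∀ i, (d i)⁻¹ * d i * (d i)⁻¹ = (d i)⁻¹ := fun i => by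
    simpa using mul_inv_mul_cancel (d i)⁻¹
  refine ⟨U * diagonal (fun i => (d i)⁻¹) * Uᵀ, hsymm _, ?_, ?_, ?_, ?_⟩
  · rw [hSd, key, key, diagonal_mul_diagonal, diagonal_mul_diagonal]
    simp only [hd]
  · rw [hSd, key, key, diagonal_mul_diagonal, diagonal_mul_diagonal]
    simp only [hd']
  · rw [hSd, key, diagonal_mul_diagonal]
    exact hsymm _
  · rw [hSd, key, diagonal_mul_diagonal]
    exact hsymm _

theorem exists_isMoorePenrose {m n : Type*} [Fintype m] [Fintype n] (A : Matrix m n ℝ) :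
    ∃ B : Matrix n m ℝ, IsMoorePenrose A B := by
  classical
  obtain ⟨P, hPs, hP⟩ := exists_isMoorePenrose_of_isSymm (Aᵀ * A)
    (by rw [transpose_mul, transpose_transpose])
  have hA : A * (P * (Aᵀ * A)) = A := by
    have h0 : A * (P * (Aᵀ * A) - 1) = 0 := by
      rw [← conjTranspose_mul_self_eq_zero, conjTranspose_mul, Matrix.mul_assoc,
        ← Matrix.mul_assoc Aᴴ, conjTranspose_eq_transpose_of_trivial A, Matrix.mul_sub,
        ← Matrix.mul_assoc (Aᵀ * A), hP.mul_mul_left, Matrix.mul_one, sub_self, Matrix.mul_zero]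
    rw [Matrix.mul_sub, Matrix.mul_one, sub_eq_zero] at h0
    exact h0
  refine ⟨P * Aᵀ, ?_, ?_, ?_, ?_⟩
  · rw [Matrix.mul_assoc, Matrix.mul_assoc, hA]
  · calc P * Aᵀ * A * (P * Aᵀ) = (P * (Aᵀ * A) * P) * Aᵀ := by simp only [Matrix.mul_assoc]
      _ = P * Aᵀ := by rw [hP.mul_mul_right]
  · simp only [transpose_mul, transpose_transpose, hPs, Matrix.mul_assoc]
  · have := hP.symm_right
    rwa [← Matrix.mul_assoc] at this

/-- The Moore-Penrose inverse `A⁺` of a real matrix. -/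
noncomputable def pinv {m n : Type*} [Fintype m] [Fintype n] (A : Matrix m n ℝ) :
    Matrix n m ℝ :=
  (exists_isMoorePenrose A).choose

theorem isMoorePenrose_pinv {m n : Type*} [Fintype m] [Fintype n] (A : Matrix m n ℝ) :
    IsMoorePenrose A (pinv A) :=
  (exists_isMoorePenrose A).choose_spec

/-! ### Samples and statistics -/

/-- A data set with `a` groups: group `i` consists of `n i` observation vectors with `t i`
components (time points). -/
abbrev Sample {a : ℕ} (t n : Fin a → ℕ) : Type :=
  (i : Fin a) → Fin (n i) → EuclideanSpace ℝ (Fin (t i))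

/-- Stack group-wise vectors into one vector indexed by all pairs (group, time point). -/
def stack {a : ℕ} {t : Fin a → ℕ} (v : (i : Fin a) → EuclideanSpace ℝ (Fin (t i))) :
    (Σ i, Fin (t i)) → ℝ :=
  fun p => v p.1 p.2

/-- The total number of subjects `N`. -/
def totalSize {a : ℕ} (n : Fin a → ℕ) : ℕ := ∑ i, n i

/-- The mean vector of group `i`. -/
noncomputable def groupMean {a : ℕ} {t n : Fin a → ℕ} (y : Sample t n) (i : Fin a) :
    EuclideanSpace ℝ (Fin (t i)) :=
  (n i : ℝ)⁻¹ • ∑ k, y i k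

/-- The (unbiased) sample covariance matrix of group `i`. -/
noncomputable def sampleCov {a : ℕ} {t n : Fin a → ℕ} (y : Sample t n) (i : Fin a) :
    Matrix (Fin (t i)) (Fin (t i)) ℝ :=
  ((n i : ℝ) - 1)⁻¹ • ∑ k, vecMulVec (fun s => y i k s - groupMean y i s)
    (fun s => y i k s - groupMean y i s)

/-- The matrix `N • ⨁ i, (1 / n i) • (sample covariance matrix of group i)`. -/
noncomputable def sigmaHat {a : ℕ} {t n : Fin a → ℕ} (y : Sample t n) :
    Matrix (Σ i, Fin (t i)) (Σ i, Fin (t i)) ℝ :=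
  (totalSize n : ℝ) • blockDiagonal' fun i => (n i : ℝ)⁻¹ • sampleCov y i

/-- The Wald-type statistic of the data set `y` for the hypothesis matrix `H`. -/
noncomputable def WTS {a r : ℕ} {t n : Fin a → ℕ} (H : Matrix (Fin r) (Σ i, Fin (t i)) ℝ)
    (y : Sample t n) : ℝ :=
  (totalSize n : ℝ) *
    (stack (groupMean y) ⬝ᵥ
      ((Hᵀ * pinv (H * sigmaHat y * Hᵀ) * H) *ᵥ stack (groupMean y)))

/-- The (standardized) ANOVA-type statistic of the data set `y`, for the hypothesis matrix `H`
and a generalized inverse `G` of `H * Hᵀ`; the projection matrix is `Hᵀ * G * H`. -/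
noncomputable def ATS {a r : ℕ} {t n : Fin a → ℕ} (H : Matrix (Fin r) (Σ i, Fin (t i)) ℝ)
    (G : Matrix (Fin r) (Fin r) ℝ) (y : Sample t n) : ℝ :=
  (totalSize n : ℝ) / (Hᵀ * G * H * sigmaHat y).trace *
    (stack (groupMean y) ⬝ᵥ ((Hᵀ * G * H) *ᵥ stack (groupMean y)))

/-! ### Model, bootstrap and limit laws -/

/-- The repeated measures model: all vectors `Y i k` are independent, those of group `i` have
distribution `F i` with finite fourth moment, mean vector `μ i` and covariance matrix `V i`. -/
structure IsModel {a : ℕ} {t : Fin a → ℕ} {Ω : Type*} [MeasurableSpace Ω] (P : Measure Ω)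
    (Y : (i : Fin a) → ℕ → Ω → EuclideanSpace ℝ (Fin (t i)))
    (F : (i : Fin a) → Measure (EuclideanSpace ℝ (Fin (t i))))
    (μ : (i : Fin a) → EuclideanSpace ℝ (Fin (t i)))
    (V : (i : Fin a) → Matrix (Fin (t i)) (Fin (t i)) ℝ) : Prop where
  indep : iIndepFun (fun (p : Fin a × ℕ) => Y p.1 p.2) P
  law : ∀ i k, HasLaw (Y i k) (F i) P
  moment : ∀ i, MemLp (fun x => x) 4 (F i)
  mean : ∀ i, ∫ x, x ∂(F i) = μ i
  cov : ∀ i s s', cov[fun x => x s, fun x => x s'; F i] = V i s s'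

/-- The observed data set: the first `n i` observation vectors of each group. -/
def observed {a : ℕ} {t : Fin a → ℕ} {Ω : Type*}
    (Y : (i : Fin a) → ℕ → Ω → EuclideanSpace ℝ (Fin (t i))) (n : Fin a → ℕ) (ω : Ω) :
    Sample t n :=
  fun i k => Y i k ω

/-- The conditional law, given the data set `y`, of the parametric bootstrap sample: all vectors
are independent, and the `n i` vectors of group `i` are centered normal with covariance matrix the
sample covariance matrix of group `i` of `y`. -/
noncomputable def bootLaw {a : ℕ} {t n : Fin a → ℕ} (y : Sample t n) : Measure (Sample t n) :=
  Measure.pi fun i => Measure.pi fun _ => multivariateGaussian 0 (sampleCov y i)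

/-- The central chi-squared distribution with `f` degrees of freedom (the point mass at `0` for
`f = 0`): the law of the sum of squares of `f` independent standard normal variables. -/
noncomputable def chiSquared (f : ℕ) : Measure ℝ :=
  (Measure.pi fun _ : Fin f => gaussianReal 0 1).map fun x => ∑ i, x i ^ 2

/-- The random measures `L m` on the real line converge weakly in probability to `ν`. -/
def TendstoWeaklyInProbability {Ω : Type*} [MeasurableSpace Ω] (P : Measure Ω)
    (L : ℕ → Ω → Measure ℝ) (ν : Measure ℝ) : Prop :=
  ∀ g : ℝ →ᵇ ℝ, TendstoInMeasure P (fun m ω => ∫ x, g x ∂(L m ω)) atTop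
    (fun _ => ∫ x, g x ∂ν)

/-- The Kolmogorov distance: the supremum over `x` of the absolute difference of the distribution
functions at `x`. -/
noncomputable def kolmogorovDist (ν ν' : Measure ℝ) : ℝ :=
  ⨆ x : ℝ, |ν.real (Set.Iic x) - ν'.real (Set.Iic x)|

end ParamBoot

namespace ParamBoot

/-! ### Linear algebra -/

/-! Both statistics have the form `N * (x ⬝ᵥ K Σ̂ *ᵥ x)`, with `x` the stacked group means and `K S
= Hᵀ * X S * H` (`quadStat`; the trace in the ANOVA-type statistic is absorbed into `X`). Since `K`
sees `x` only through `H *ᵥ x`, a mean vector in the kernel of `H` drops out. What is left is a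
quadratic form in the standardized group means with a random weight: the means obey a central limit
theorem, the weight converges by the strong law, and Slutsky's theorem gives the limit. This is
`tendstoInDistribution_quadStat`, proved for data multiplied by converging matrices `R m i`.

That generality handles the bootstrap. Given the data, the bootstrap law depends only on the sample
sizes and the sample covariance matrices `S`, and a sample from N(0, S) is `CFC.sqrt S` applied to a
standard normal sample. Along any deterministic positive semidefinite sequence `S → V` the bootstrap
is thus a fixed i.i.d. model transformed by matrices converging to `CFC.sqrt V`, and no
triangular-array limit theorem is needed. The original null statistic is the case `R = 1`, and both
have the limit `limitLaw`. As the sample covariances converge almost surely to `V`,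
`tendstoInMeasure_of_forall_seq` turns deterministic convergence into convergence in probability.

The Moore-Penrose inverse is discontinuous in general. A factorization `H = B * C` with `B` left
invertible and `C` right invertible gives `Hᵀ * (H S Hᵀ)⁺ * H = Cᵀ * (C S Cᵀ)⁻¹ * C` for `S` near
the positive definite limit. This yields continuity and, after whitening, the chi-squared law with
`H.rank` degrees of freedom.

The uniform statements follow from Pólya's theorem and the triangle inequality through `limitLaw`,
which has no atoms because the relevant trace is nonzero when `H.rank ≠ 0`. For `H.rank = 0` both
statistics vanish identically. -/

theorem exists_rank_factorization {m n : Type*} [Fintype m] [Fintype n] [DecidableEq m]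
    [DecidableEq n] (H : Matrix m n ℝ) :
    ∃ (B : Matrix m (Fin H.rank) ℝ) (C : Matrix (Fin H.rank) n ℝ)
      (L : Matrix (Fin H.rank) m ℝ) (R : Matrix n (Fin H.rank) ℝ),
      H = B * C ∧ L * B = 1 ∧ C * R = 1 := by
  set φ := Matrix.toLin' H with hφ
  have hr : Module.finrank ℝ (LinearMap.range φ) = Module.finrank ℝ (Fin H.rank → ℝ) := by
    rw [Module.finrank_fin_fun, Matrix.rank, hφ, Matrix.toLin'_apply']
  let e := LinearEquiv.ofFinrankEq _ _ hr
  let β : (Fin H.rank → ℝ) →ₗ[ℝ] (m → ℝ) := (LinearMap.range φ).subtype ∘ₗ e.symm.toLinearMap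
  let γ : (n → ℝ) →ₗ[ℝ] (Fin H.rank → ℝ) := e.toLinearMap ∘ₗ φ.rangeRestrict
  have hβγ : φ = β ∘ₗ γ := by ext x; simp [β, γ]
  have hβ : LinearMap.ker β = ⊥ := by
    rw [LinearMap.ker_eq_bot]
    exact Subtype.val_injective.comp e.symm.injective
  have hγ : LinearMap.range γ = ⊤ := by
    rw [LinearMap.range_eq_top]
    exact e.surjective.comp (LinearMap.surjective_rangeRestrict φ)
  obtain ⟨l, hl⟩ := β.exists_leftInverse_of_injective hβ
  obtain ⟨s, hs⟩ := γ.exists_rightInverse_of_surjective hγ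
  refine ⟨β.toMatrix', γ.toMatrix', l.toMatrix', s.toMatrix', ?_, ?_, ?_⟩
  · rw [← LinearMap.toMatrix'_comp, ← hβγ, hφ, LinearMap.toMatrix'_toLin']
  · rw [← LinearMap.toMatrix'_comp, hl, LinearMap.toMatrix'_id]
  · rw [← LinearMap.toMatrix'_comp, hs, LinearMap.toMatrix'_id]

/-- Cancelling `B` by its left inverse on both sides of `A P A = A` leaves `M (Bᵀ P B) M = M`, and
`M` is invertible. Only this one equation is used, so the choice of generalized inverse is
immaterial; the result serves both `pinv` and `G`. -/
theorem transpose_mul_genInverse_mul {m f : Type*} [Fintype m] [Fintype f] [DecidableEq f]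
    {A P : Matrix m m ℝ} (hP : A * P * A = A) {B : Matrix m f ℝ} {M : Matrix f f ℝ}
    {L : Matrix f m ℝ} (hL : L * B = 1) (hA : A = B * M * Bᵀ) (hM : IsUnit M.det) :
    Bᵀ * P * B = M⁻¹ := by
  have hLt : Bᵀ * Lᵀ = 1 := by rw [← transpose_mul, hL, transpose_one]
  have h1 : M * (Bᵀ * P * B) * M = M := by
    calc M * (Bᵀ * P * B) * M
        = (L * B) * M * (Bᵀ * P * B) * M * (Bᵀ * Lᵀ) := by rw [hL, hLt]; simp
      _ = L * ((B * M * Bᵀ) * P * (B * M * Bᵀ)) * Lᵀ := by simp only [Matrix.mul_assoc]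
      _ = L * (B * M * Bᵀ) * Lᵀ := by rw [← hA, hP]
      _ = (L * B) * M * (Bᵀ * Lᵀ) := by simp only [Matrix.mul_assoc]
      _ = M := by rw [hL, hLt]; simp
  calc Bᵀ * P * B = (M⁻¹ * M) * (Bᵀ * P * B) * (M * M⁻¹) := by
        rw [nonsing_inv_mul _ hM, mul_nonsing_inv _ hM]; simp
    _ = M⁻¹ * (M * (Bᵀ * P * B) * M) * M⁻¹ := by simp only [Matrix.mul_assoc]
    _ = M⁻¹ := by rw [h1, nonsing_inv_mul _ hM, Matrix.one_mul]

theorem transpose_mul_genInverse_mul_of_factor {m n f : Type*} [Fintype m] [Fintype n] [Fintype f]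
    [DecidableEq f] {H : Matrix m n ℝ} {B : Matrix m f ℝ} {C : Matrix f n ℝ} {L : Matrix f m ℝ}
    (hH : H = B * C) (hL : L * B = 1) {S : Matrix n n ℝ} (hS : IsUnit (C * S * Cᵀ).det)
    {P : Matrix m m ℝ} (hP : (H * S * Hᵀ) * P * (H * S * Hᵀ) = H * S * Hᵀ) :
    Hᵀ * P * H = Cᵀ * (C * S * Cᵀ)⁻¹ * C := by
  have hA : H * S * Hᵀ = B * (C * S * Cᵀ) * Bᵀ := by
    rw [hH, transpose_mul]; simp only [Matrix.mul_assoc]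
  rw [← transpose_mul_genInverse_mul hP hL hA hS, hH, transpose_mul]
  simp only [Matrix.mul_assoc]

theorem PosDef.mul_mul_transpose_of_rightInverse {n f : Type*} [Fintype n] [Fintype f]
    [DecidableEq f] {C : Matrix f n ℝ} {R : Matrix n f ℝ} (hC : C * R = 1) {S : Matrix n n ℝ}
    (hS : S.PosDef) : (C * S * Cᵀ).PosDef := by
  rw [← conjTranspose_eq_transpose_of_trivial]
  refine hS.mul_mul_conjTranspose_same fun v w h => ?_
  have h' := congrArg (· ᵥ* R) h
  simpa [vecMul_vecMul, hC] using h'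

theorem continuousAt_inv_of_isUnit_det {f : Type*} [Fintype f] [DecidableEq f] {M : Matrix f f ℝ}
    (hM : IsUnit M.det) : ContinuousAt (fun A : Matrix f f ℝ => A⁻¹) M := by
  refine continuousAt_matrix_inv _ ?_
  rw [Ring.inverse_eq_inv']
  exact continuousAt_inv₀ hM.ne_zero

/-- Invertibility of `C S Cᵀ` is an open condition that holds at `S₀`, so near `S₀` the
pseudoinverse can be traded for an ordinary inverse. -/
theorem continuousAt_transpose_mul_pinv_mul {m n : Type*} [Fintype m] [Fintype n]
    [DecidableEq m] [DecidableEq n] (H : Matrix m n ℝ) {S₀ : Matrix n n ℝ} (hS₀ : S₀.PosDef) :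
    ContinuousAt (fun S : Matrix n n ℝ => Hᵀ * pinv (H * S * Hᵀ) * H) S₀ := by
  obtain ⟨B, C, L, R, hH, hL, hR⟩ := exists_rank_factorization H
  have hM : IsUnit (C * S₀ * Cᵀ).det :=
    (PosDef.mul_mul_transpose_of_rightInverse hR hS₀).det_pos.ne'.isUnit
  have hc : Continuous fun S : Matrix n n ℝ => C * S * Cᵀ := by fun_prop
  have hev : ∀ᶠ S in 𝓝 S₀, IsUnit (C * S * Cᵀ).det := by
    have : ContinuousAt (fun S : Matrix n n ℝ => (C * S * Cᵀ).det) S₀ :=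
      (hc.matrix_det).continuousAt
    filter_upwards [this.eventually_ne hM.ne_zero] with S hS using hS.isUnit
  have hcont : ContinuousAt (fun S : Matrix n n ℝ => Cᵀ * (C * S * Cᵀ)⁻¹ * C) S₀ := by
    have h1 : ContinuousAt (fun S : Matrix n n ℝ => (C * S * Cᵀ)⁻¹) S₀ :=
      ContinuousAt.comp (f := fun S : Matrix n n ℝ => C * S * Cᵀ)
        (continuousAt_inv_of_isUnit_det hM) hc.continuousAt
    have h2 : Continuous fun X : Matrix (Fin H.rank) (Fin H.rank) ℝ => Cᵀ * X * C := by fun_prop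
    exact ContinuousAt.comp (f := fun S : Matrix n n ℝ => (C * S * Cᵀ)⁻¹)
      h2.continuousAt h1
  refine hcont.congr ?_
  filter_upwards [hev] with S hS
  exact (transpose_mul_genInverse_mul_of_factor hH hL hS
    (isMoorePenrose_pinv (H * S * Hᵀ)).mul_mul_left).symm

theorem PosDef.exists_isUnit_transpose_mul_self {f : Type*} [Fintype f] [DecidableEq f]
    {M : Matrix f f ℝ} (hM : M.PosDef) : ∃ W : Matrix f f ℝ, IsUnit W ∧ M = Wᵀ * W := by
  open scoped MatrixOrder Matrix.Norms.L2Operator in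
  obtain ⟨W, hW, h⟩ := CStarAlgebra.isStrictlyPositive_iff_eq_star_mul_self.1
    hM.isStrictlyPositive
  exact ⟨W, hW, by rwa [star_eq_conjTranspose, conjTranspose_eq_transpose_of_trivial] at h⟩

/-- Spectral resolution of the Moore-Penrose inverse of a symmetric matrix as a limit. -/
theorem tendsto_mul_inv_sq_add_pinv {n : Type*} [Fintype n] [DecidableEq n]
    (S : Matrix n n ℝ) (hS : Sᵀ = S) :
    Tendsto (fun k : ℕ => S * (S * S + ((k : ℝ) + 1)⁻¹ • (1 : Matrix n n ℝ))⁻¹) atTop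
      (𝓝 (pinv S)) := by
  have hH : S.IsHermitian := by
    rw [Matrix.IsHermitian, conjTranspose_eq_transpose_of_trivial, hS]
  obtain ⟨U, d, hU, hSd⟩ : ∃ (U : Matrix n n ℝ) (d : n → ℝ),
      Uᵀ * U = 1 ∧ S = U * diagonal d * Uᵀ := by
    refine ⟨hH.eigenvectorUnitary, hH.eigenvalues, ?_, ?_⟩
    · have := Unitary.coe_star_mul_self hH.eigenvectorUnitary
      simpa [star_eq_conjTranspose, conjTranspose_eq_transpose_of_trivial] using this
    · have := hH.spectral_theorem
      simpa [Unitary.conjStarAlgAut_apply, star_eq_conjTranspose,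
        conjTranspose_eq_transpose_of_trivial, Function.comp_def] using this
  have hU' : U * Uᵀ = 1 := mul_eq_one_comm.1 hU
  have key : ∀ X Z : Matrix n n ℝ, (U * X * Uᵀ) * (U * Z * Uᵀ) = U * (X * Z) * Uᵀ := by
    intro X Z
    calc (U * X * Uᵀ) * (U * Z * Uᵀ) = U * X * (Uᵀ * U) * Z * Uᵀ := by
          simp only [Matrix.mul_assoc]
      _ = U * (X * Z) * Uᵀ := by rw [hU]; simp only [Matrix.mul_assoc, Matrix.one_mul]
  have hsymm : ∀ e : n → ℝ, (U * diagonal e * Uᵀ)ᵀ = U * diagonal e * Uᵀ := by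
    intro e
    simp only [transpose_mul, transpose_transpose, diagonal_transpose, Matrix.mul_assoc]
  have hd' : ∀ i, (d i)⁻¹ * d i * (d i)⁻¹ = (d i)⁻¹ := fun i => by
    simpa using mul_inv_mul_cancel (d i)⁻¹
  have hp : pinv S = U * diagonal (fun i => (d i)⁻¹) * Uᵀ := by
    refine (isMoorePenrose_pinv S).unique ⟨?_, ?_, ?_, ?_⟩
    · rw [hSd, key, key, diagonal_mul_diagonal, diagonal_mul_diagonal]
      simp only [mul_inv_mul_cancel]
    · rw [hSd, key, key, diagonal_mul_diagonal, diagonal_mul_diagonal]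
      simp only [hd']
    · rw [hSd, key, diagonal_mul_diagonal]; exact hsymm _
    · rw [hSd, key, diagonal_mul_diagonal]; exact hsymm _
  have hk : ∀ k : ℕ, S * (S * S + ((k : ℝ) + 1)⁻¹ • (1 : Matrix n n ℝ))⁻¹ =
      U * diagonal (fun i => d i * (d i * d i + ((k : ℝ) + 1)⁻¹)⁻¹) * Uᵀ := by
    intro k
    have hpos : ∀ i, d i * d i + ((k : ℝ) + 1)⁻¹ ≠ 0 := fun i =>
      (add_pos_of_nonneg_of_pos (mul_self_nonneg _) (by positivity)).ne'
    have h1 : (S * S + ((k : ℝ) + 1)⁻¹ • (1 : Matrix n n ℝ)) =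
        U * diagonal (fun i => d i * d i + ((k : ℝ) + 1)⁻¹) * Uᵀ := by
      have : diagonal (fun i => d i * d i + ((k : ℝ) + 1)⁻¹) =
          diagonal (fun i => d i * d i) + ((k : ℝ) + 1)⁻¹ • (1 : Matrix n n ℝ) := by
        rw [← diagonal_one, ← diagonal_smul, diagonal_add]
        simp
      rw [this, hSd, key, diagonal_mul_diagonal, Matrix.mul_add, Matrix.add_mul]
      simp [hU']
    have h2 : (S * S + ((k : ℝ) + 1)⁻¹ • (1 : Matrix n n ℝ))⁻¹ =
        U * diagonal (fun i => (d i * d i + ((k : ℝ) + 1)⁻¹)⁻¹) * Uᵀ := by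
      refine inv_eq_right_inv ?_
      rw [h1, key, diagonal_mul_diagonal]
      simp [hpos, hU']
    rw [h2]
    nth_rewrite 1 [hSd]
    rw [key, diagonal_mul_diagonal]
  simp_rw [hk, hp]
  -- On each eigenvalue the regularized quotient `d / (d² + ε)` tends to `1 / d`, and it is exactly
  -- `0` when `d = 0`, in accordance with the convention `0⁻¹ = 0`.
  have hd : Tendsto (fun (k : ℕ) (i : n) => d i * (d i * d i + ((k : ℝ) + 1)⁻¹)⁻¹) atTop
      (𝓝 fun i => (d i)⁻¹) := by
    refine tendsto_pi_nhds.2 fun i => ?_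
    rcases eq_or_ne (d i) 0 with h | h
    · simp [h]
    · have h0 : Tendsto (fun k : ℕ => ((k : ℝ) + 1)⁻¹) atTop (𝓝 0) := by
        simpa [one_div] using tendsto_one_div_add_atTop_nhds_zero_nat (𝕜 := ℝ)
      have h1 : Tendsto (fun k : ℕ => d i * (d i * d i + ((k : ℝ) + 1)⁻¹)⁻¹) atTop
          (𝓝 (d i * (d i * d i + 0)⁻¹)) :=
        ((h0.const_add _).inv₀ (by simpa using h)).const_mul _
      convert h1 using 2
      field_simp
      simp
  have hcont : Continuous fun e : n → ℝ => U * diagonal e * Uᵀ := by fun_prop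
  exact (hcont.tendsto _).comp hd

/-! ### Measurability of the inverse and of the Moore-Penrose inverse. -/

theorem measurable_matrix_inv {Ω n : Type*} [MeasurableSpace Ω] [Fintype n] [DecidableEq n]
    {A : Ω → Matrix n n ℝ} (hA : ∀ i j, Measurable fun ω => A ω i j) (i j : n) :
    Measurable fun ω => (A ω)⁻¹ i j := by
  have h : Measurable (fun ω => (show n → n → ℝ from A ω)) :=
    measurable_pi_lambda _ fun i => measurable_pi_lambda _ fun j => hA i j
  have hid : Continuous fun a : n → n → ℝ => (Matrix.of a : Matrix n n ℝ) := continuous_id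
  have hdet : Measurable fun ω => (A ω).det :=
    (show Continuous fun a : n → n → ℝ => (Matrix.of a).det from
      hid.matrix_det).measurable.comp h
  have hadj : Measurable fun ω => (A ω).adjugate i j :=
    (show Continuous fun a : n → n → ℝ => (Matrix.of a).adjugate i j from
      hid.matrix_adjugate.matrix_elem i j).measurable.comp h
  simp only [Matrix.inv_def, Matrix.smul_apply, Ring.inverse_eq_inv', smul_eq_mul]
  exact hdet.inv.mul hadj

theorem measurable_matrix_mul {Ω l m n : Type*} [MeasurableSpace Ω] [Fintype m]
    {A : Ω → Matrix l m ℝ} {B : Ω → Matrix m n ℝ} (hA : ∀ i j, Measurable fun ω => A ω i j)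
    (hB : ∀ i j, Measurable fun ω => B ω i j) (i : l) (j : n) :
    Measurable fun ω => (A ω * B ω) i j := by
  simp only [Matrix.mul_apply]
  exact Finset.measurable_sum _ fun k _ => (hA i k).mul (hB k j)

/-- As `pinv` is neither continuous nor given by a formula in the entries, it is obtained as a
pointwise limit of the regularized inverses `S (S² + ε)⁻¹`, which are measurable by Cramer's rule.
-/
theorem measurable_pinv {Ω n : Type*} [MeasurableSpace Ω] [Fintype n]
    {A : Ω → Matrix n n ℝ} (hA : ∀ i j, Measurable fun ω => A ω i j) (hs : ∀ ω, (A ω)ᵀ = A ω)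
    (i j : n) : Measurable fun ω => pinv (A ω) i j := by
  classical
  refine measurable_of_tendsto_metrizable
    (f := fun (k : ℕ) ω => (A ω * (A ω * A ω + ((k : ℝ) + 1)⁻¹ • (1 : Matrix n n ℝ))⁻¹) i j)
    (fun k => ?_) ?_
  · refine measurable_matrix_mul hA (measurable_matrix_inv fun i j => ?_) i j
    exact (measurable_matrix_mul hA hA i j).add measurable_const
  · refine tendsto_pi_nhds.2 fun ω => ?_
    exact ((continuous_id.matrix_elem i j).tendsto _).comp (tendsto_mul_inv_sq_add_pinv _ (hs ω))

/-! ### Central limit theorem for random vectors -/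

theorem variance_inner_eq {ι : Type*} [Fintype ι] {ν : Measure (EuclideanSpace ℝ ι)}
    [IsProbabilityMeasure ν] (hν : MemLp (fun x => x) 2 ν) {V : Matrix ι ι ℝ}
    (hV : ∀ s s', cov[fun x => x s, fun x => x s'; ν] = V s s') (ξ : EuclideanSpace ℝ ι) :
    Var[fun x => inner ℝ x ξ; ν] = ξ ⬝ᵥ V *ᵥ ξ := by
  have hc : ∀ s, MemLp (fun x : EuclideanSpace ℝ ι => x s) 2 ν := fun s => hν.eval_piLp s
  have h : (fun x : EuclideanSpace ℝ ι => inner ℝ x ξ) = fun x => ∑ s, ξ s * x s := by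
    ext x; simp [PiLp.inner_apply]
  rw [h, ← covariance_self (Finset.aemeasurable_fun_sum _ fun s _ =>
    ((hc s).aestronglyMeasurable.aemeasurable.const_mul _)),
    covariance_fun_sum_fun_sum (fun s => (hc s).const_mul _) (fun s => (hc s).const_mul _)]
  simp only [covariance_const_mul_left, covariance_const_mul_right, hV, dotProduct, mulVec,
    Finset.mul_sum]
  refine Finset.sum_congr rfl fun s _ => Finset.sum_congr rfl fun s' _ => by ring

theorem charFun_map_eq_charFun_inner {Ω E : Type*} [MeasurableSpace Ω] [NormedAddCommGroup E]
    [InnerProductSpace ℝ E] [MeasurableSpace E] [BorelSpace E] [SecondCountableTopology E]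
    {P : Measure Ω} {X : Ω → E} (hX : AEMeasurable X P) (ξ : E) :
    charFun (P.map X) ξ = charFun (P.map fun ω => inner ℝ (X ω) ξ) 1 := by
  rw [charFun_apply, charFun_apply, integral_map hX (by fun_prop),
    integral_map (by fun_prop) (by fun_prop)]
  simp

/-- Cramér-Wold: the characteristic function at `ξ` is that of the projection on `ξ` at `1`, to
which the one-dimensional central limit theorem applies. -/
theorem tendsto_map_sqrt_smul_mean_sub {Ω ι : Type*} [MeasurableSpace Ω] [Fintype ι]
    [DecidableEq ι] {P : Measure Ω} [IsProbabilityMeasure P] {X : ℕ → Ω → EuclideanSpace ℝ ι}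
    {ν : Measure (EuclideanSpace ℝ ι)} (hindep : iIndepFun X P) (hlaw : ∀ k, HasLaw (X k) ν P)
    (hν : MemLp (fun x => x) 2 ν) {μ : EuclideanSpace ℝ ι} (hμ : ∫ x, x ∂ν = μ)
    {V : Matrix ι ι ℝ} (hVp : V.PosSemidef)
    (hV : ∀ s s', cov[fun x => x s, fun x => x s'; ν] = V s s')
    (hm : ∀ n : ℕ, AEMeasurable
      (fun ω => √(n : ℝ) • ((n : ℝ)⁻¹ • (∑ k : Fin n, X k ω) - μ)) P) :
    Tendsto (β := ProbabilityMeasure (EuclideanSpace ℝ ι))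
      (fun n : ℕ => ⟨P.map fun ω => √(n : ℝ) • ((n : ℝ)⁻¹ • (∑ k : Fin n, X k ω) - μ),
        Measure.isProbabilityMeasure_map (hm n)⟩) atTop
      (𝓝 ⟨multivariateGaussian 0 V, inferInstance⟩) := by
  have : IsProbabilityMeasure ν := (hlaw 0).isProbabilityMeasure_iff.1 inferInstance
  refine ProbabilityMeasure.tendsto_iff_tendsto_charFun.2 fun ξ => ?_
  have hlaw' : ∀ k, HasLaw (fun ω => inner ℝ (X k ω) ξ) (ν.map fun x => inner ℝ x ξ) P :=
    fun k => HasLaw.fun_comp (Y := fun x => inner ℝ x ξ) ⟨by fun_prop, rfl⟩ (hlaw k)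
  have hvar : Var[fun ω => inner ℝ (X 0 ω) ξ; P] = ξ ⬝ᵥ V *ᵥ ξ := by
    rw [← variance_inner_eq hν hV ξ, ← (hlaw 0).map_eq,
      variance_map (by fun_prop) (hlaw 0).aemeasurable]
    rfl
  have hL2 : MemLp (X 0) 2 P := by
    have := (memLp_map_measure_iff (f := X 0) (μ := P) (g := fun x => x) (p := 2)
      (by fun_prop) (hlaw 0).aemeasurable).1 (by rw [(hlaw 0).map_eq]; exact hν)
    exact this
  have hmean : P[fun ω => inner ℝ (X 0 ω) ξ] = inner ℝ μ ξ := by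
    have h := integral_inner (𝕜 := ℝ) (memLp_one_iff_integrable.1 (hL2.mono_exponent one_le_two)) ξ
    rw [(hlaw 0).integral_eq, hμ] at h
    simp_rw [real_inner_comm ξ]
    exact h
  have hclt := tendstoInDistribution_inv_sqrt_mul_sum_sub (P := P)
    (P' := gaussianReal 0 Var[fun ω => inner ℝ (X 0 ω) ξ; P].toNNReal)
    (X := fun k ω => inner ℝ (X k ω) ξ) (Y := id) ⟨aemeasurable_id, Measure.map_id⟩
    (hL2.inner_const ξ) (hindep.comp (fun _ x => inner ℝ x ξ) (fun _ => by fun_prop))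
    (fun k => (hlaw' k).identDistrib (hlaw' 0))
  have h1 := ProbabilityMeasure.tendsto_iff_tendsto_charFun.1 hclt.tendsto 1
  simp only [ProbabilityMeasure.coe_mk, Measure.map_id] at h1 ⊢
  rw [charFun_multivariateGaussian hVp]
  rw [charFun_gaussianReal, hvar, hmean] at h1
  convert h1 using 2 with n
  · rw [charFun_map_eq_charFun_inner (hm n)]
    congr 2
    ext ω
    rw [real_inner_smul_left, inner_sub_left, real_inner_smul_left, sum_inner,
      ← Fin.sum_univ_eq_sum_range (fun k => inner ℝ (X k ω) ξ)]
    -- For `n = 0` both normalizations are `0`.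
    rcases Nat.eq_zero_or_pos n with rfl | hn
    · simp
    · have : (0 : ℝ) < n := by exact_mod_cast hn
      have hs : √(n : ℝ) * √(n : ℝ) = n := Real.mul_self_sqrt this.le
      have : √(n : ℝ) ≠ 0 := (Real.sqrt_pos.2 this).ne'
      field_simp
      rw [pow_two, hs]
  · have h0 : 0 ≤ ξ ⬝ᵥ V *ᵥ ξ := by rw [← hvar]; exact variance_nonneg _ _
    simp [h0]

/-! ### Laws of the observed data -/

variable {a : ℕ} {t : Fin a → ℕ} {Ω : Type*} [MeasurableSpace Ω] {P : Measure Ω}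
  [IsProbabilityMeasure P]
  {Y : (i : Fin a) → ℕ → Ω → EuclideanSpace ℝ (Fin (t i))}
  {F : (i : Fin a) → Measure (EuclideanSpace ℝ (Fin (t i)))}
  {μ : (i : Fin a) → EuclideanSpace ℝ (Fin (t i))}
  {V : (i : Fin a) → Matrix (Fin (t i)) (Fin (t i)) ℝ}

omit [IsProbabilityMeasure P] in
theorem aemeasurable_observed (hY : ∀ i k, AEMeasurable (Y i k) P) (n : Fin a → ℕ) :
    AEMeasurable (observed Y n) P :=
  aemeasurable_pi_iff.2 fun i => aemeasurable_pi_iff.2 fun k => hY i k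

/-- The observed vectors form a subfamily of the independent family, indexed by a sigma type;
currying turns their joint law into the iterated product used in `bootLaw`. -/
theorem map_observed_eq_pi (hindep : iIndepFun (fun (p : Fin a × ℕ) => Y p.1 p.2) P)
    (hlaw : ∀ i k, HasLaw (Y i k) (F i) P) (n : Fin a → ℕ) :
    P.map (observed Y n) = Measure.pi fun i => Measure.pi fun _ : Fin (n i) => F i := by
  have : ∀ i, IsProbabilityMeasure (F i) :=
    fun i => (hlaw i 0).isProbabilityMeasure_iff.1 inferInstance
  have hinj : Function.Injective fun p : (i : Fin a) × Fin (n i) => (p.1, (p.2 : ℕ)) := by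
    rintro ⟨i, k⟩ ⟨j, l⟩ h
    simp only [Prod.mk.injEq] at h
    obtain ⟨rfl, h⟩ := h
    simpa using Fin.ext h
  have h1 := (hindep.precomp hinj).map_fun_eq_pi_map fun p => (hlaw p.1 p.2).aemeasurable
  simp only [(hlaw _ _).map_eq] at h1
  have h2 := Measure.infinitePi_map_piCurry
    (X := fun (i : Fin a) (_ : Fin (n i)) => EuclideanSpace ℝ (Fin (t i))) fun i _ => F i
  simp only [Measure.infinitePi_eq_pi] at h2
  rw [← h2, ← h1, AEMeasurable.map_map_of_aemeasurable (by fun_prop)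
    (aemeasurable_pi_iff.2 fun p => (hlaw p.1 p.2).aemeasurable)]
  rfl

theorem iIndepFun_observed (hindep : iIndepFun (fun (p : Fin a × ℕ) => Y p.1 p.2) P)
    (hlaw : ∀ i k, HasLaw (Y i k) (F i) P) (n : Fin a → ℕ) :
    iIndepFun (fun i ω => observed Y n ω i) P := by
  have : ∀ i, IsProbabilityMeasure (F i) :=
    fun i => (hlaw i 0).isProbabilityMeasure_iff.1 inferInstance
  have hm := aemeasurable_observed (fun i k => (hlaw i k).aemeasurable) n
  rw [iIndepFun_iff_map_fun_eq_pi_map (fun i => aemeasurable_pi_iff.1 hm i)]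
  have h := map_observed_eq_pi hindep hlaw n
  change P.map (observed Y n) = _
  rw [h]
  congr 1
  ext1 i
  have h2 : P.map (fun ω => observed Y n ω i) = (P.map (observed Y n)).map (fun y => y i) := by
    rw [AEMeasurable.map_map_of_aemeasurable (measurable_pi_apply i).aemeasurable
      hm]
    rfl
  rw [h2, h, (measurePreserving_eval _ i).map_eq]

/-! ### Quadratic statistics -/

section Algebra

variable {a : ℕ} {t n : Fin a → ℕ}

/-- Apply the matrix `R i` to all observation vectors of group `i`. -/
noncomputable def transform (R : (i : Fin a) → Matrix (Fin (t i)) (Fin (t i)) ℝ)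
    (y : Sample t n) : Sample t n :=
  fun i k => toEuclideanCLM (𝕜 := ℝ) (R i) (y i k)

/-- The statistic `N * (x ⬝ᵥ K(Σ) *ᵥ x)`, where `x` is the vector of group means and `Σ` is the
estimated covariance matrix. -/
noncomputable def quadStat
    (K : Matrix (Σ i, Fin (t i)) (Σ i, Fin (t i)) ℝ → Matrix (Σ i, Fin (t i)) (Σ i, Fin (t i)) ℝ)
    (y : Sample t n) : ℝ :=
  (totalSize n : ℝ) * (stack (groupMean y) ⬝ᵥ (K (sigmaHat y) *ᵥ stack (groupMean y)))

theorem groupMean_transform (R : (i : Fin a) → Matrix (Fin (t i)) (Fin (t i)) ℝ)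
    (y : Sample t n) (i : Fin a) :
    groupMean (transform R y) i = toEuclideanCLM (𝕜 := ℝ) (R i) (groupMean y i) := by
  simp [groupMean, transform, map_sum]

theorem sampleCov_transform (R : (i : Fin a) → Matrix (Fin (t i)) (Fin (t i)) ℝ)
    (y : Sample t n) (i : Fin a) :
    sampleCov (transform R y) i = R i * sampleCov y i * (R i)ᵀ := by
  have h : ∀ k, (fun s => transform R y i k s - groupMean (transform R y) i s) =
      R i *ᵥ fun s => y i k s - groupMean y i s := by
    intro k
    ext s
    rw [groupMean_transform]
    have : (fun s => y i k s - groupMean y i s) =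
      (y i k).ofLp - (groupMean y i).ofLp := rfl
    rw [this, mulVec_sub]
    simp [transform]
  simp only [sampleCov, h, Matrix.mul_smul, Matrix.smul_mul, Matrix.mul_sum, Matrix.sum_mul,
    mul_vecMulVec, vecMulVec_mul, vecMul_transpose]

theorem blockDiagonal'_mulVec_stack (M : (i : Fin a) → Matrix (Fin (t i)) (Fin (t i)) ℝ)
    (v : (i : Fin a) → EuclideanSpace ℝ (Fin (t i))) :
    blockDiagonal' M *ᵥ stack v = stack fun i => toEuclideanCLM (𝕜 := ℝ) (M i) (v i) := by
  ext ⟨i, s⟩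
  simp only [mulVec, dotProduct, stack, Fintype.sum_sigma]
  rw [Finset.sum_eq_single i]
  · simp [mulVec, dotProduct, blockDiagonal'_apply_eq]
  · intro j _ hj
    exact Finset.sum_eq_zero fun s' _ => by rw [blockDiagonal'_apply_ne _ _ _ hj.symm, zero_mul]
  · simp

theorem stack_add (v w : (i : Fin a) → EuclideanSpace ℝ (Fin (t i))) :
    stack (fun i => v i + w i) = stack v + stack w := rfl

/-- An exact identity that isolates what converges: the shift `R μ` is killed by `H`, and `√N = √(N
/ n i) * √(n i)` moves the unbounded factor into the standardized means, leaving bounded block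
weights. -/
theorem quadStat_transform_eq {r : ℕ} {H : Matrix (Fin r) (Σ i, Fin (t i)) ℝ}
    {K : Matrix (Σ i, Fin (t i)) (Σ i, Fin (t i)) ℝ → Matrix (Σ i, Fin (t i)) (Σ i, Fin (t i)) ℝ}
    {X : Matrix (Σ i, Fin (t i)) (Σ i, Fin (t i)) ℝ → Matrix (Fin r) (Fin r) ℝ}
    (hK : ∀ S, K S = Hᵀ * X S * H) {R : (i : Fin a) → Matrix (Fin (t i)) (Fin (t i)) ℝ}
    {μ : (i : Fin a) → EuclideanSpace ℝ (Fin (t i))}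
    (hμ : H *ᵥ stack (fun i => toEuclideanCLM (𝕜 := ℝ) (R i) (μ i)) = 0)
    (hn : ∀ i, 0 < n i) (y : Sample t n) :
    quadStat K (transform R y) =
      stack (fun i => √(n i : ℝ) • (groupMean y i - μ i)) ⬝ᵥ
        (((blockDiagonal' fun i => √((totalSize n : ℝ) / n i) • R i)ᵀ *
          K (sigmaHat (transform R y)) * blockDiagonal' fun i => √((totalSize n : ℝ) / n i) • R i) *ᵥ
          stack (fun i => √(n i : ℝ) • (groupMean y i - μ i))) := by
  set S := sigmaHat (transform R y)
  set N : ℝ := (totalSize n : ℝ)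
  have hN : 0 ≤ N := Nat.cast_nonneg _
  set w := stack (fun i => toEuclideanCLM (𝕜 := ℝ) (R i) (groupMean y i - μ i)) with hw
  have h1 : blockDiagonal' (fun i => √(N / n i) • R i) *ᵥ
      stack (fun i => √(n i : ℝ) • (groupMean y i - μ i)) = √N • w := by
    rw [blockDiagonal'_mulVec_stack, hw]
    ext ⟨i, s⟩
    have hni : (0 : ℝ) < n i := by exact_mod_cast hn i
    have : √(N / n i) * √(n i : ℝ) = √N := by
      rw [← Real.sqrt_mul (by positivity), div_mul_cancel₀ _ hni.ne']
    simp only [stack, map_smul, Pi.smul_apply, smul_eq_mul, _root_.smul_apply,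
      PiLp.smul_apply, ← this]
    ring
  have h2 : stack (groupMean (transform R y)) =
      w + stack (fun i => toEuclideanCLM (𝕜 := ℝ) (R i) (μ i)) := by
    rw [hw, ← stack_add]
    congr 1
    ext1 i
    rw [groupMean_transform, ← map_add, sub_add_cancel]
  have h3 : ∀ x, x ⬝ᵥ (K S *ᵥ x) = (H *ᵥ x) ⬝ᵥ (X S *ᵥ (H *ᵥ x)) := by
    intro x
    rw [hK, dotProduct_mulVec, ← vecMul_vecMul, ← vecMul_vecMul, vecMul_transpose,
      ← dotProduct_mulVec, ← dotProduct_mulVec]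
  rw [← mulVec_mulVec, ← mulVec_mulVec, h1, dotProduct_mulVec, vecMul_transpose, h1]
  rw [quadStat, h3, h2, mulVec_add, hμ, add_zero, ← h3, mulVec_smul, smul_dotProduct,
    dotProduct_smul, smul_smul, Real.mul_self_sqrt hN, smul_eq_mul]

/-! ### Sample covariances: moment form, positivity, measurability. -/

theorem sampleCov_apply_eq (y : Sample t n) (i : Fin a) (s s' : Fin (t i)) :
    sampleCov y i s s' = ((n i : ℝ) * ((n i : ℝ) - 1)⁻¹) *
      ((n i : ℝ)⁻¹ * (∑ k, y i k s * y i k s') - groupMean y i s * groupMean y i s') := by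
  rcases Nat.eq_zero_or_pos (n i) with h0 | hpos
  · have : IsEmpty (Fin (n i)) := by rw [h0]; infer_instance
    simp [sampleCov, h0]
  have hne : (n i : ℝ) ≠ 0 := by positivity
  have hs : ∀ s, ∑ k, y i k s = (n i : ℝ) * groupMean y i s := by
    intro s
    simp [groupMean, hne]
  simp only [sampleCov, Matrix.smul_apply, Matrix.sum_apply, vecMulVec_apply, smul_eq_mul,
    sub_mul, mul_sub, Finset.sum_sub_distrib, ← Finset.mul_sum, ← Finset.sum_mul, hs,
    Finset.sum_const, Finset.card_univ, Fintype.card_fin, nsmul_eq_mul]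
  field_simp
  ring

theorem sampleCov_transpose (y : Sample t n) (i : Fin a) : (sampleCov y i)ᵀ = sampleCov y i := by
  ext s s'
  rw [transpose_apply, sampleCov_apply_eq, sampleCov_apply_eq]
  simp only [mul_comm]

theorem posSemidef_sampleCov (y : Sample t n) (i : Fin a) : (sampleCov y i).PosSemidef := by
  have h : (∑ k, vecMulVec (fun s => y i k s - groupMean y i s)
      (fun s => y i k s - groupMean y i s)).PosSemidef :=
    posSemidef_sum _ fun k _ => by
      simpa using posSemidef_vecMulVec_self_star (fun s => y i k s - groupMean y i s)
  -- An empty group has the negative factor `(0 - 1)⁻¹`, harmless because the sum is empty; for one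
  -- observation the factor is `0⁻¹ = 0`.
  rcases Nat.eq_zero_or_pos (n i) with h0 | hpos
  · have : IsEmpty (Fin (n i)) := by rw [h0]; infer_instance
    simpa [sampleCov] using PosSemidef.zero
  · refine h.smul (inv_nonneg.2 (sub_nonneg.2 ?_))
    exact_mod_cast hpos

theorem sigmaHat_transpose (y : Sample t n) : (sigmaHat y)ᵀ = sigmaHat y := by
  simp [sigmaHat, transpose_smul, blockDiagonal'_transpose, sampleCov_transpose]

@[fun_prop]
theorem measurable_groupMean (i : Fin a) (s : Fin (t i)) :
    Measurable fun y : Sample t n => groupMean y i s := by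
  simp only [groupMean, PiLp.smul_apply]
  fun_prop

theorem measurable_sampleCov (i : Fin a) (s s' : Fin (t i)) :
    Measurable fun y : Sample t n => sampleCov y i s s' := by
  simp only [sampleCov_apply_eq]
  fun_prop

theorem measurable_sigmaHat (p q : Σ i, Fin (t i)) :
    Measurable fun y : Sample t n => sigmaHat y p q := by
  obtain ⟨i, s⟩ := p
  obtain ⟨j, s'⟩ := q
  by_cases h : i = j
  · subst h
    simp only [sigmaHat, Matrix.smul_apply, blockDiagonal'_apply_eq]
    exact ((measurable_sampleCov i s s').const_mul _).const_mul _
  · simp only [sigmaHat, Matrix.smul_apply, blockDiagonal'_apply_ne _ _ _ h]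
    exact measurable_const

theorem measurable_quadStat
    {K : Matrix (Σ i, Fin (t i)) (Σ i, Fin (t i)) ℝ → Matrix (Σ i, Fin (t i)) (Σ i, Fin (t i)) ℝ}
    (hK : ∀ p q, Measurable fun y : Sample t n => K (sigmaHat y) p q) :
    Measurable fun y : Sample t n => quadStat K y := by
  simp only [quadStat, dotProduct, mulVec, stack]
  exact measurable_const.mul (Finset.measurable_sum _ fun p _ => (measurable_groupMean _ _).mul
    (Finset.measurable_sum _ fun q _ => (hK p q).mul (measurable_groupMean _ _)))

@[fun_prop]
theorem measurable_transform (R : (i : Fin a) → Matrix (Fin (t i)) (Fin (t i)) ℝ) :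
    Measurable fun y : Sample t n => transform R y := by
  unfold transform
  fun_prop

end Algebra

/-! ### Asymptotics of the group means and of the sample covariance matrices -/

section Asymptotics

variable {a : ℕ} {t : Fin a → ℕ} {Ω : Type*} [MeasurableSpace Ω] {P : Measure Ω}
  [IsProbabilityMeasure P]
  {Y : (i : Fin a) → ℕ → Ω → EuclideanSpace ℝ (Fin (t i))}
  {F : (i : Fin a) → Measure (EuclideanSpace ℝ (Fin (t i)))}
  {μ : (i : Fin a) → EuclideanSpace ℝ (Fin (t i))}
  {V : (i : Fin a) → Matrix (Fin (t i)) (Fin (t i)) ℝ}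

theorem tendsto_natCast_mul_inv_sub_one :
    Tendsto (fun n : ℕ => (n : ℝ) * ((n : ℝ) - 1)⁻¹) atTop (𝓝 1) := by
  have h : Tendsto (fun n : ℕ => 1 + ((n : ℝ) - 1)⁻¹) atTop (𝓝 (1 + 0)) := by
    refine Tendsto.const_add _ (tendsto_inv_atTop_zero.comp ?_)
    exact tendsto_atTop_add_const_right _ _ tendsto_natCast_atTop_atTop
  rw [add_zero] at h
  refine h.congr' ?_
  filter_upwards [eventually_gt_atTop 1] with n hn
  have : (n : ℝ) - 1 ≠ 0 := sub_ne_zero.2 (by exact_mod_cast hn.ne')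
  field_simp
  ring

theorem IsModel.isProbabilityMeasure (hY : IsModel P Y F μ V) (i : Fin a) :
    IsProbabilityMeasure (F i) :=
  (hY.law i 0).isProbabilityMeasure_iff.1 inferInstance

theorem IsModel.memLp_two (hY : IsModel P Y F μ V) (i : Fin a) :
    MemLp (fun x => x) 2 (F i) := by
  have := hY.isProbabilityMeasure i
  exact (hY.moment i).mono_exponent (by norm_num)

omit [IsProbabilityMeasure P] in
theorem IsModel.iIndepFun_group (hY : IsModel P Y F μ V) (i : Fin a) :
    iIndepFun (Y i) P :=
  hY.indep.precomp (g := fun k => (i, k)) fun k l h => by simpa using h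

omit [IsProbabilityMeasure P] in
theorem IsModel.tendsto_average (hY : IsModel P Y F μ V) (i : Fin a)
    {φ : EuclideanSpace ℝ (Fin (t i)) → ℝ} (hφ : Measurable φ) (hint : Integrable φ (F i)) :
    ∀ᵐ ω ∂P, Tendsto (fun n : ℕ => (n : ℝ)⁻¹ * ∑ k : Fin n, φ (Y i k ω)) atTop
      (𝓝 (∫ x, φ x ∂(F i))) := by
  have hlaw : ∀ k, HasLaw (fun ω => φ (Y i k ω)) ((F i).map φ) P :=
    fun k => HasLaw.fun_comp (Y := φ) ⟨hφ.aemeasurable, rfl⟩ (hY.law i k)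
  have h := strong_law_ae (μ := P) (fun k ω => φ (Y i k ω))
    ((integrable_map_measure hφ.aestronglyMeasurable (hY.law i 0).aemeasurable).1
      ((hY.law i 0).map_eq.symm ▸ hint))
    (fun k l hkl => ((hY.iIndepFun_group i).indepFun hkl).comp hφ hφ)
    (fun k => (hlaw k).identDistrib (hlaw 0))
  have hm : ∫ ω, φ (Y i 0 ω) ∂P = ∫ x, φ x ∂(F i) :=
    (hY.law i 0).integral_comp hint.aestronglyMeasurable
  filter_upwards [h] with ω hω
  rw [hm] at hω
  refine hω.congr fun n => ?_
  rw [smul_eq_mul, ← Fin.sum_univ_eq_sum_range (fun k => φ (Y i k ω))]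

/-- In moment form the sample covariance is a continuous function of averages of first and second
order products, to which the strong law applies. -/
theorem IsModel.ae_tendsto_sampleCov (hY : IsModel P Y F μ V) {n : ℕ → Fin a → ℕ}
    (hn : ∀ i, Tendsto (fun m => n m i) atTop atTop) :
    ∀ᵐ ω ∂P, ∀ i, Tendsto (fun m => sampleCov (observed Y (n m) ω) i) atTop (𝓝 (V i)) := by
  rw [ae_all_iff]
  intro i
  have := hY.isProbabilityMeasure i
  have h2 : ∀ s, MemLp (fun x : EuclideanSpace ℝ (Fin (t i)) => x s) 2 (F i) :=
    fun s => (hY.memLp_two i).eval_piLp s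
  have hA : ∀ᵐ ω ∂P, ∀ s, Tendsto (fun n : ℕ => (n : ℝ)⁻¹ * ∑ k : Fin n, Y i k ω s) atTop
      (𝓝 (∫ x, x s ∂(F i))) := ae_all_iff.2 fun s =>
    hY.tendsto_average i (φ := fun x => x s) (by fun_prop) ((h2 s).integrable one_le_two)
  have hB : ∀ᵐ ω ∂P, ∀ s s', Tendsto
      (fun n : ℕ => (n : ℝ)⁻¹ * ∑ k : Fin n, Y i k ω s * Y i k ω s') atTop
      (𝓝 (∫ x, x s * x s' ∂(F i))) := ae_all_iff.2 fun s => ae_all_iff.2 fun s' =>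
    hY.tendsto_average i (φ := fun x => x s * x s') (by fun_prop) ((h2 s).integrable_mul (h2 s'))
  filter_upwards [hA, hB] with ω hAω hBω
  refine tendsto_pi_nhds.2 fun s => tendsto_pi_nhds.2 fun s' => ?_
  have hlim := ((tendsto_natCast_mul_inv_sub_one.mul
    ((hBω s s').sub ((hAω s).mul (hAω s')))).comp (hn i))
  have hV : V i s s' = ∫ x, x s * x s' ∂(F i) - (∫ x, x s ∂(F i)) * ∫ x, x s' ∂(F i) := by
    rw [← hY.cov i s s', covariance_eq_sub (h2 s) (h2 s')]
    rfl
  rw [one_mul, ← hV] at hlim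
  refine hlim.congr fun m => ?_
  rw [sampleCov_apply_eq]
  simp [groupMean, observed]

/-- Joint central limit theorem for the standardized group means. -/
theorem IsModel.tendstoInDistribution_groupMean (hY : IsModel P Y F μ V)
    (hV : ∀ i, (V i).PosSemidef) {n : ℕ → Fin a → ℕ}
    (hn : ∀ i, Tendsto (fun m => n m i) atTop atTop) :
    TendstoInDistribution
      (fun m ω i => √(n m i : ℝ) • (groupMean (observed Y (n m) ω) i - μ i)) atTop id
      (fun _ => P) (Measure.pi fun i => multivariateGaussian 0 (V i)) := by
  have hYm : ∀ i k, AEMeasurable (Y i k) P := fun i k => (hY.law i k).aemeasurable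
  have hm : ∀ i (n : ℕ), AEMeasurable
      (fun ω => √(n : ℝ) • ((n : ℝ)⁻¹ • (∑ k : Fin n, Y i k ω) - μ i)) P := by
    intro i n
    fun_prop
  have hlim : ∀ i, Tendsto (β := ProbabilityMeasure (EuclideanSpace ℝ (Fin (t i))))
      (fun m => ⟨P.map fun ω => √(n m i : ℝ) •
        ((n m i : ℝ)⁻¹ • (∑ k : Fin (n m i), Y i k ω) - μ i),
        Measure.isProbabilityMeasure_map (hm i (n m i))⟩) atTop
      (𝓝 ⟨multivariateGaussian 0 (V i), inferInstance⟩) := fun i =>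
    (tendsto_map_sqrt_smul_mean_sub (hY.iIndepFun_group i) (hY.law i) (hY.memLp_two i)
      (hY.mean i) (hV i) (hY.cov i) (hm i)).comp (hn i)
  -- The groups are independent, so the joint law is a product, and forming products is weakly
  -- continuous.
  have hpi := (ProbabilityMeasure.continuous_pi.tendsto _).comp (tendsto_pi_nhds.2 hlim)
  refine ⟨fun m => aemeasurable_pi_iff.2 fun i => hm i (n m i), aemeasurable_id, ?_⟩
  have hind : ∀ m, P.map (fun ω i => √(n m i : ℝ) • (groupMean (observed Y (n m) ω) i - μ i)) =
      Measure.pi fun i => P.map fun ω => √(n m i : ℝ) •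
        ((n m i : ℝ)⁻¹ • (∑ k : Fin (n m i), Y i k ω) - μ i) := by
    intro m
    refine ((iIndepFun_observed hY.indep hY.law (n m)).comp
      (fun i x => √(n m i : ℝ) • ((n m i : ℝ)⁻¹ • (∑ k, x k) - μ i))
      (fun i => by fun_prop)).map_fun_eq_pi_map fun i => hm i (n m i)
  have hid : (⟨(Measure.pi fun i => multivariateGaussian 0 (V i)).map id,
      Measure.isProbabilityMeasure_map aemeasurable_id⟩ :
        ProbabilityMeasure ((i : Fin a) → EuclideanSpace ℝ (Fin (t i)))) =
      ProbabilityMeasure.pi fun i => ⟨multivariateGaussian 0 (V i), inferInstance⟩ :=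
    Subtype.ext Measure.map_id
  rw [hid]
  exact hpi.congr fun m => Subtype.ext (hind m).symm

theorem tendsto_blockDiagonal' {ι : Type*} {l : Filter ι}
    {M : ι → (i : Fin a) → Matrix (Fin (t i)) (Fin (t i)) ℝ}
    {M₀ : (i : Fin a) → Matrix (Fin (t i)) (Fin (t i)) ℝ}
    (h : ∀ i, Tendsto (fun m => M m i) l (𝓝 (M₀ i))) :
    Tendsto (fun m => blockDiagonal' (M m)) l (𝓝 (blockDiagonal' M₀)) := by
  have hb : Continuous fun M : (i : Fin a) → Matrix (Fin (t i)) (Fin (t i)) ℝ =>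
      blockDiagonal' M := Continuous.matrix_blockDiagonal' continuous_id
  exact (hb.tendsto M₀).comp (tendsto_pi_nhds.2 h)

theorem tendsto_matrix_mul {ι p q s : Type*} [Fintype q] {l : Filter ι} {A : ι → Matrix p q ℝ}
    {B : ι → Matrix q s ℝ} {A₀ : Matrix p q ℝ} {B₀ : Matrix q s ℝ} (hA : Tendsto A l (𝓝 A₀))
    (hB : Tendsto B l (𝓝 B₀)) : Tendsto (fun m => A m * B m) l (𝓝 (A₀ * B₀)) := by
  have hc : Continuous fun p : Matrix p q ℝ × Matrix q s ℝ => p.1 * p.2 := by fun_prop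
  have h : Tendsto (fun m => (A m, B m)) l (𝓝 (A₀, B₀)) := hA.prodMk_nhds hB
  have h0 := hc.tendsto (A₀, B₀)
  exact h0.comp h

theorem tendsto_matrix_transpose {ι p q : Type*} {l : Filter ι} {A : ι → Matrix p q ℝ}
    {A₀ : Matrix p q ℝ} (hA : Tendsto A l (𝓝 A₀)) : Tendsto (fun m => (A m)ᵀ) l (𝓝 A₀ᵀ) :=
  ((continuous_id.matrix_transpose).tendsto A₀).comp hA

theorem measurable_const_mul_mul_const {Ω l m n o : Type*} [MeasurableSpace Ω] [Fintype m]
    [Fintype n] (A : Matrix l m ℝ) {B : Ω → Matrix m n ℝ} (C : Matrix n o ℝ)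
    (hB : ∀ i j, Measurable fun ω => B ω i j) (i : l) (j : o) :
    Measurable fun ω => (A * B ω * C) i j :=
  measurable_matrix_mul (A := fun ω => A * B ω) (B := fun _ => C)
    (measurable_matrix_mul (A := fun _ => A) (fun _ _ => measurable_const) hB)
    (fun _ _ => measurable_const) i j

theorem IsModel.ae_tendsto_sigmaHat_transform (hY : IsModel P Y F μ V) {n : ℕ → Fin a → ℕ}
    (hn : ∀ i, Tendsto (fun m => n m i) atTop atTop)
    {κ : Fin a → ℝ} (hκ : ∀ i, 0 < κ i)
    (hnκ : ∀ i, Tendsto (fun m => (n m i : ℝ) / (totalSize (n m) : ℝ)) atTop (𝓝 (κ i)))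
    {R : ℕ → (i : Fin a) → Matrix (Fin (t i)) (Fin (t i)) ℝ}
    {R₀ : (i : Fin a) → Matrix (Fin (t i)) (Fin (t i)) ℝ}
    (hR : ∀ i, Tendsto (fun m => R m i) atTop (𝓝 (R₀ i))) :
    ∀ᵐ ω ∂P, Tendsto (fun m => sigmaHat (transform (R m) (observed Y (n m) ω))) atTop
      (𝓝 (blockDiagonal' fun i => (κ i)⁻¹ • (R₀ i * V i * (R₀ i)ᵀ))) := by
  filter_upwards [hY.ae_tendsto_sampleCov hn] with ω hω
  have h : ∀ i, Tendsto (fun m => ((n m i : ℝ) / (totalSize (n m) : ℝ))⁻¹ •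
      (R m i * sampleCov (observed Y (n m) ω) i * (R m i)ᵀ)) atTop
      (𝓝 ((κ i)⁻¹ • (R₀ i * V i * (R₀ i)ᵀ))) := by
    intro i
    exact ((hnκ i).inv₀ (hκ i).ne').smul
      (tendsto_matrix_mul (tendsto_matrix_mul (hR i) (hω i)) (tendsto_matrix_transpose (hR i)))
  refine (tendsto_blockDiagonal' h).congr fun m => ?_
  simp only [sigmaHat, ← blockDiagonal'_smul, sampleCov_transform]
  congr 1
  ext1 i
  rw [Pi.smul_apply, smul_smul, inv_div, div_eq_mul_inv]

/-- Limit law of a quadratic statistic of linearly transformed data. -/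
theorem IsModel.tendstoInDistribution_quadStat (hY : IsModel P Y F μ V)
    (hV : ∀ i, (V i).PosSemidef) {n : ℕ → Fin a → ℕ}
    (hn : ∀ i, Tendsto (fun m => n m i) atTop atTop)
    {κ : Fin a → ℝ} (hκ : ∀ i, 0 < κ i)
    (hnκ : ∀ i, Tendsto (fun m => (n m i : ℝ) / (totalSize (n m) : ℝ)) atTop (𝓝 (κ i)))
    {R : ℕ → (i : Fin a) → Matrix (Fin (t i)) (Fin (t i)) ℝ}
    {R₀ : (i : Fin a) → Matrix (Fin (t i)) (Fin (t i)) ℝ}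
    (hR : ∀ i, Tendsto (fun m => R m i) atTop (𝓝 (R₀ i)))
    {r : ℕ} {H : Matrix (Fin r) (Σ i, Fin (t i)) ℝ}
    {K : Matrix (Σ i, Fin (t i)) (Σ i, Fin (t i)) ℝ → Matrix (Σ i, Fin (t i)) (Σ i, Fin (t i)) ℝ}
    {X : Matrix (Σ i, Fin (t i)) (Σ i, Fin (t i)) ℝ → Matrix (Fin r) (Fin r) ℝ}
    (hK : ∀ S, K S = Hᵀ * X S * H)
    (hμ : ∀ m, H *ᵥ stack (fun i => toEuclideanCLM (𝕜 := ℝ) (R m i) (μ i)) = 0)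
    (hKm : ∀ (n : Fin a → ℕ) (p q), Measurable fun y : Sample t n => K (sigmaHat y) p q)
    (hKc : ContinuousAt K (blockDiagonal' fun i => (κ i)⁻¹ • (R₀ i * V i * (R₀ i)ᵀ))) :
    TendstoInDistribution
      (fun m ω => quadStat K (transform (R m) (observed Y (n m) ω))) atTop
      (fun z => stack z ⬝ᵥ (((blockDiagonal' fun i => √(κ i)⁻¹ • R₀ i)ᵀ *
          K (blockDiagonal' fun i => (κ i)⁻¹ • (R₀ i * V i * (R₀ i)ᵀ)) *
          blockDiagonal' fun i => √(κ i)⁻¹ • R₀ i) *ᵥ stack z))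
      (fun _ => P) (Measure.pi fun i => multivariateGaussian 0 (V i)) := by
  have hYm : ∀ i k, AEMeasurable (Y i k) P := fun i k => (hY.law i k).aemeasurable
  have hobs : ∀ m, AEMeasurable (observed Y (n m)) P := fun m => aemeasurable_observed hYm (n m)
  set S₀ := blockDiagonal' fun i => (κ i)⁻¹ • (R₀ i * V i * (R₀ i)ᵀ)
  let D : ℕ → Matrix (Σ i, Fin (t i)) (Σ i, Fin (t i)) ℝ := fun m =>
    blockDiagonal' fun i => √((totalSize (n m) : ℝ) / n m i) • R m i
  let D₀ : Matrix (Σ i, Fin (t i)) (Σ i, Fin (t i)) ℝ := blockDiagonal' fun i => √(κ i)⁻¹ • R₀ i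
  let c : ℕ → Ω → (Σ i, Fin (t i)) → (Σ i, Fin (t i)) → ℝ := fun m ω =>
    (D m)ᵀ * K (sigmaHat (transform (R m) (observed Y (n m) ω))) * D m
  let g : ((i : Fin a) → EuclideanSpace ℝ (Fin (t i))) ×
      ((Σ i, Fin (t i)) → (Σ i, Fin (t i)) → ℝ) → ℝ :=
    fun p => stack p.1 ⬝ᵥ ((Matrix.of p.2) *ᵥ stack p.1)
  have hg : Continuous g := by
    simp only [g, dotProduct, mulVec, stack, Matrix.of_apply]
    fun_prop
  have hD : Tendsto D atTop (𝓝 D₀) := by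
    refine tendsto_blockDiagonal' fun i => Tendsto.smul ?_ (hR i)
    refine (Real.continuous_sqrt.tendsto _).comp ?_
    simpa only [inv_div] using (hnκ i).inv₀ (hκ i).ne'
  have hc_meas : ∀ m, AEMeasurable (c m) P := by
    intro m
    have : Measurable fun y : Sample t (n m) => (show (Σ i, Fin (t i)) → (Σ i, Fin (t i)) → ℝ from
        (D m)ᵀ * K (sigmaHat (transform (R m) y)) * D m) := by
      refine measurable_pi_lambda _ fun p => measurable_pi_lambda _ fun q => ?_
      exact measurable_const_mul_mul_const (D m)ᵀ (D m)
        (fun p q => (hKm (n m) p q).comp (measurable_transform (R m))) p q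
    exact this.comp_aemeasurable (hobs m)
  have hc_lim : TendstoInMeasure P c atTop fun _ => D₀ᵀ * K S₀ * D₀ := by
    refine tendstoInMeasure_of_tendsto_ae (fun m => (hc_meas m).aestronglyMeasurable) ?_
    filter_upwards [hY.ae_tendsto_sigmaHat_transform hn hκ hnκ hR] with ω hω
    exact tendsto_matrix_mul (tendsto_matrix_mul (tendsto_matrix_transpose hD)
      (hKc.tendsto.comp hω)) hD
  -- Slutsky: the means converge in law and the weights in probability to a constant matrix.
  have h := (hY.tendstoInDistribution_groupMean hV hn).continuous_comp_prodMk_of_tendstoInMeasure_const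
    hg hc_lim hc_meas
  refine ⟨fun m => ?_, h.aemeasurable_limit, ?_⟩
  · exact ((measurable_quadStat (hKm (n m))).comp (measurable_transform (R m))).comp_aemeasurable
      (hobs m)
  · refine h.tendsto.congr' ?_
    -- The exact identity requires nonempty groups, hence agreement only for large `m`.
    have hpos : ∀ᶠ m in atTop, ∀ i, 0 < n m i :=
      eventually_all.2 fun i => (hn i).eventually_gt_atTop 0
    filter_upwards [hpos] with m hm
    refine Subtype.ext ?_
    change P.map _ = P.map _
    congr 1
    ext ω
    exact (quadStat_transform_eq hK (hμ m) hm _).symm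

end Asymptotics

/-! ### Quadratic forms of standard normal vectors -/

/-- The law of a vector of independent standard normal variables indexed by `ι`. -/
noncomputable abbrev stdNormal (ι : Type*) [Fintype ι] : Measure (ι → ℝ) :=
  Measure.pi fun _ => gaussianReal 0 1

/-- `B` has orthonormal rows, so `Bᵀ` preserves norms, and the standard normal characteristic
function depends on the norm alone. -/
theorem map_mulVec_stdNormal {ι f : Type*} [Fintype ι] [Fintype f] [DecidableEq f]
    {B : Matrix f ι ℝ} (hB : B * Bᵀ = 1) :
    (stdNormal ι).map (fun u => B *ᵥ u) = stdNormal f := by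
  have hBm : Measurable fun u : ι → ℝ => B *ᵥ u :=
    (continuous_const.matrix_mulVec continuous_id).measurable
  have h : ((stdNormal ι).map (fun u => B *ᵥ u)).map (WithLp.toLp 2) =
      (stdNormal f).map (WithLp.toLp 2) := by
    rw [map_pi_eq_stdGaussian]
    refine Measure.ext_of_charFun (funext fun ξ => ?_)
    have hadj : ∀ u : ι → ℝ, inner ℝ (WithLp.toLp 2 (B *ᵥ u)) ξ =
        inner ℝ (WithLp.toLp 2 u) (WithLp.toLp 2 (Bᵀ *ᵥ ξ.ofLp)) := by
      intro u
      simp only [EuclideanSpace.inner_eq_star_dotProduct, star_trivial]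
      rw [dotProduct_mulVec, mulVec_transpose]
    have h1 : charFun (((stdNormal ι).map (fun u => B *ᵥ u)).map (WithLp.toLp 2)) ξ =
        charFun ((stdNormal ι).map (WithLp.toLp 2)) (WithLp.toLp 2 (Bᵀ *ᵥ ξ.ofLp)) := by
      rw [charFun_apply, charFun_apply, Measure.map_map (by fun_prop) hBm,
        integral_map (by fun_prop) (by fun_prop), integral_map (by fun_prop) (by fun_prop)]
      simp only [Function.comp_apply, hadj]
    rw [h1, map_pi_eq_stdGaussian, charFun_stdGaussian, charFun_stdGaussian]
    have h2 : ‖(WithLp.toLp 2 (Bᵀ *ᵥ ξ.ofLp) : EuclideanSpace ℝ ι)‖ ^ 2 = ‖ξ‖ ^ 2 := by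
      rw [← real_inner_self_eq_norm_sq, ← real_inner_self_eq_norm_sq, ← hadj, mulVec_mulVec, hB,
        one_mulVec]
    have h3 : ((‖(WithLp.toLp 2 (Bᵀ *ᵥ ξ.ofLp) : EuclideanSpace ℝ ι)‖ : ℂ)) ^ 2 =
        (‖ξ‖ : ℂ) ^ 2 := by exact_mod_cast h2
    rw [h3]
  have h' := congrArg (Measure.map (WithLp.ofLp (p := 2) (V := f → ℝ))) h
  have hcomp : ∀ ν : Measure (f → ℝ), (ν.map (WithLp.toLp 2)).map WithLp.ofLp = ν := fun ν => by
    rw [Measure.map_map (by fun_prop) (by fun_prop)]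
    exact Measure.map_id
  rwa [hcomp, hcomp] at h'

theorem map_quadForm_stdNormal_eq_chiSquared {ι : Type*} [Fintype ι] {f : ℕ}
    {B : Matrix (Fin f) ι ℝ} (hB : B * Bᵀ = 1) :
    (stdNormal ι).map (fun u => u ⬝ᵥ ((Bᵀ * B) *ᵥ u)) = chiSquared f := by
  have hBm : Measurable fun u : ι → ℝ => B *ᵥ u :=
    (continuous_const.matrix_mulVec continuous_id).measurable
  have h := map_mulVec_stdNormal hB
  simp only [stdNormal] at h ⊢
  rw [chiSquared, ← h, Measure.map_map (by fun_prop) hBm]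
  congr 1
  ext u
  rw [← mulVec_mulVec, dotProduct_mulVec, vecMul_transpose]
  simp [dotProduct, pow_two]

theorem finite_setOf_quadratic_eq {α : ℝ} (hα : α ≠ 0) (b c d : ℝ) :
    {y : ℝ | d + y * b + y * y * α = c}.Finite := by
  open Polynomial in
  set p : ℝ[X] := C α * X ^ 2 + C b * X + C (d - c) with hp
  have hp0 : p ≠ 0 := by
    intro h
    have := congrArg natDegree h
    rw [hp, natDegree_quadratic hα] at this
    simp at this
  refine (p.roots.toFinset.finite_toSet).subset fun y hy => ?_
  simp only [Set.mem_ofPred_eq] at hy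
  rw [Finset.mem_coe, Multiset.mem_toFinset, Polynomial.mem_roots hp0, Polynomial.IsRoot.def, hp]
  simp only [Polynomial.eval_add, Polynomial.eval_mul, Polynomial.eval_C, Polynomial.eval_pow,
    Polynomial.eval_X]
  rw [← hy]
  ring

theorem continuous_quadForm {ι : Type*} [Fintype ι] (A : Matrix ι ι ℝ) :
    Continuous fun u : ι → ℝ => u ⬝ᵥ (A *ᵥ u) := by
  simp only [dotProduct, mulVec]
  fun_prop

/-- A nonzero trace forces a nonzero diagonal entry `A p p`. With the other coordinates fixed, the
form is a genuine quadratic in coordinate `p`, so each level set meets the line in finitely many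
points, a Gaussian null set; Fubini concludes. -/
theorem nullSingletonClass_map_quadForm_stdNormal {ι : Type*} [Fintype ι] {A : Matrix ι ι ℝ}
    (hA : A.trace ≠ 0) : NullSingletonClass ((stdNormal ι).map fun u => u ⬝ᵥ (A *ᵥ u)) := by
  classical
  obtain ⟨p, -, hp⟩ := Finset.exists_ne_zero_of_sum_ne_zero hA
  refine ⟨fun c => ?_⟩
  have hq := (continuous_quadForm A).measurable
  rw [Measure.map_apply hq (measurableSet_singleton c)]
  set E : Set (ι → ℝ) := (fun u => u ⬝ᵥ (A *ᵥ u)) ⁻¹' {c} with hE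
  have hEm : MeasurableSet E := hq (measurableSet_singleton c)
  rw [← lintegral_indicator_one hEm]
  have hf : Measurable (E.indicator (1 : (ι → ℝ) → ENNReal)) := measurable_one.indicator hEm
  -- Fubini in the single coordinate `p`: it suffices that the marginal integral over this
  -- coordinate vanishes.
  have key := lintegral_eq_of_lmarginal_eq (μ := fun _ : ι => gaussianReal 0 1) {p} hf
    (measurable_const (a := (0 : ENNReal))) ?_
  · rw [key, lintegral_zero]
  rw [lmarginal_singleton, lmarginal_singleton]
  ext x
  simp only [lintegral_zero]
  have hset : (fun y : ℝ => E.indicator (1 : (ι → ℝ) → ENNReal) (Function.update x p y)) =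
      {y : ℝ | Function.update x p y ∈ E}.indicator 1 := by
    ext y
    simp [Set.indicator_apply]
  have hm : MeasurableSet {y : ℝ | Function.update x p y ∈ E} :=
    (measurable_update x) hEm
  rw [hset, lintegral_indicator_one hm]
  have := nullSingletonClass_gaussianReal (μ := 0) (v := 1) one_ne_zero
  refine Set.Finite.measure_zero ?_ _
  set x₀ := Function.update x p 0
  refine (finite_setOf_quadratic_eq hp (x₀ ⬝ᵥ (A *ᵥ Pi.single p 1) + Pi.single p 1 ⬝ᵥ (A *ᵥ x₀)) c
    (x₀ ⬝ᵥ (A *ᵥ x₀))).subset fun y hy => ?_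
  have hu : Function.update x p y = x₀ + y • Pi.single p 1 := by
    ext q
    by_cases hq : q = p
    · subst hq; simp [x₀]
    · simp [x₀, hq]
  have hy' : (x₀ + y • Pi.single p 1) ⬝ᵥ (A *ᵥ (x₀ + y • Pi.single p 1)) = c := by
    rw [← hu]; exact hy
  simp only [Set.mem_ofPred_eq]
  rw [← hy']
  simp only [mulVec_add, mulVec_smul, dotProduct_add, add_dotProduct, dotProduct_smul,
    smul_dotProduct, smul_eq_mul]
  have : (Pi.single p (1 : ℝ)) ⬝ᵥ (A *ᵥ Pi.single p 1) = A.diag p := by simp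
  rw [this]
  ring

/-! ### Kolmogorov distance -/

theorem bddAbove_range_abs_cdf_sub (ν ν' : Measure ℝ) [IsProbabilityMeasure ν]
    [IsProbabilityMeasure ν'] :
    BddAbove (Set.range fun x : ℝ => |ν.real (Set.Iic x) - ν'.real (Set.Iic x)|) := by
  refine ⟨1, ?_⟩
  rintro _ ⟨x, rfl⟩
  have h1 := measureReal_nonneg (μ := ν) (s := Set.Iic x)
  have h2 := measureReal_nonneg (μ := ν') (s := Set.Iic x)
  have h3 := measureReal_le_one (μ := ν) (s := Set.Iic x)
  have h4 := measureReal_le_one (μ := ν') (s := Set.Iic x)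
  exact abs_le.2 ⟨by linarith, by linarith⟩

theorem kolmogorovDist_nonneg (ν ν' : Measure ℝ) : 0 ≤ kolmogorovDist ν ν' :=
  Real.iSup_nonneg fun _ => abs_nonneg _

theorem kolmogorovDist_self (ν : Measure ℝ) : kolmogorovDist ν ν = 0 := by
  simp [kolmogorovDist]

theorem kolmogorovDist_le_add (ν₁ ν₂ ν : Measure ℝ) [IsProbabilityMeasure ν₁]
    [IsProbabilityMeasure ν₂] [IsProbabilityMeasure ν] :
    kolmogorovDist ν₁ ν₂ ≤ kolmogorovDist ν₁ ν + kolmogorovDist ν₂ ν := by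
  refine ciSup_le fun x => ?_
  have h1 := le_ciSup (bddAbove_range_abs_cdf_sub ν₁ ν) x
  have h2 := le_ciSup (bddAbove_range_abs_cdf_sub ν₂ ν) x
  rw [abs_sub_comm] at h2
  exact (abs_sub_le _ (ν.real (Set.Iic x)) _).trans (add_le_add h1 h2)

theorem continuous_measureReal_Iic (ν : Measure ℝ) [IsProbabilityMeasure ν] [NullSingletonClass ν] :
    Continuous fun x => ν.real (Set.Iic x) := by
  rw [continuous_iff_continuousAt]
  intro x
  have hc : ContinuousAt (cdf ν) x := by
    have h0 := (cdf ν).measure_singleton x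
    rw [measure_cdf, measure_singleton, eq_comm, ENNReal.ofReal_eq_zero, sub_nonpos] at h0
    rw [(cdf ν).mono.continuousAt_iff_leftLim_eq_rightLim, (cdf ν).rightLim_eq]
    exact le_antisymm ((cdf ν).mono.leftLim_le le_rfl) h0
  simpa only [← cdf_eq_real] using hc

/-- **Pólya's theorem**: weak convergence to a law without atoms implies uniform convergence of the
distribution functions. -/
theorem tendsto_kolmogorovDist {ι : Type*} {l : Filter ι} {ν : ι → ProbabilityMeasure ℝ}
    {ν₀ : Measure ℝ} [hp : IsProbabilityMeasure ν₀] [NullSingletonClass ν₀]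
    (h : Tendsto ν l (𝓝 ⟨ν₀, hp⟩)) :
    Tendsto (fun i => kolmogorovDist (ν i) ν₀) l (𝓝 0) := by
  set G : ℝ → ℝ := fun x => ν₀.real (Set.Iic x) with hG
  have hGc : Continuous G := continuous_measureReal_Iic _
  have hGm : Monotone G := fun x y hxy => measureReal_mono (Set.Iic_subset_Iic.2 hxy)
  have hpt : ∀ x, Tendsto (fun i => (ν i : Measure ℝ).real (Set.Iic x)) l (𝓝 (G x)) := by
    intro x
    have := ProbabilityMeasure.tendsto_measure_of_null_frontier_of_tendsto' h (E := Set.Iic x)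
      (by rw [frontier_Iic]; exact measure_singleton (μ := ν₀) x)
    exact (ENNReal.tendsto_toReal (measure_ne_top _ _)).comp this
  have hlow : Tendsto G atBot (𝓝 0) := by
    simpa only [hG, ← cdf_eq_real] using tendsto_cdf_atBot ν₀
  have hupp : Tendsto G atTop (𝓝 1) := by
    simpa only [hG, ← cdf_eq_real] using tendsto_cdf_atTop ν₀
  have hquant : ∀ q ∈ Set.Ioo (0 : ℝ) 1, ∃ x, G x = q := by
    intro q hq
    obtain ⟨x, hx⟩ := (hlow.eventually_lt_const hq.1).exists
    obtain ⟨y, hy⟩ := (hupp.eventually_const_lt hq.2).exists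
    exact mem_range_of_exists_le_of_exists_ge hGc ⟨x, hx.le⟩ ⟨y, hy.le⟩
  rw [Metric.tendsto_nhds]
  intro ε hε
  -- The grid consists of the `j / k` quantiles of the limit. Convergence at these finitely many
  -- points costs `ε / 4`, and the mesh `1 / k` another `ε / 4`.
  obtain ⟨k, hk⟩ := exists_nat_gt (4 / ε)
  have hk0 : (0 : ℝ) < k := lt_trans (by positivity) hk
  have hkε : 1 / (k : ℝ) < ε / 4 := by
    rw [div_lt_iff₀ hk0]
    rw [div_lt_iff₀ hε] at hk
    linarith
  choose! x hx using hquant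
  have hev : ∀ᶠ i in l, ∀ j ∈ Finset.range k, |(ν i : Measure ℝ).real (Set.Iic (x ((j : ℝ) / k))) -
      G (x ((j : ℝ) / k))| < ε / 4 := by
    rw [Filter.eventually_all_finset]
    intro j _
    exact (Metric.tendsto_nhds.1 (hpt _)) _ (by positivity)
  filter_upwards [hev] with i hi
  have hmono : Monotone fun y => (ν i : Measure ℝ).real (Set.Iic y) :=
    fun y z hyz => measureReal_mono (Set.Iic_subset_Iic.2 hyz)
  have hj : ∀ j : ℕ, 0 < j → j < k → |(ν i : Measure ℝ).real (Set.Iic (x ((j : ℝ) / k))) -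
      (j : ℝ) / k| < ε / 4 ∧ G (x ((j : ℝ) / k)) = (j : ℝ) / k := by
    intro j hj0 hjk
    have h0 : G (x ((j : ℝ) / k)) = (j : ℝ) / k := by
      refine hx _ ⟨by positivity, ?_⟩
      rw [div_lt_one hk0]
      exact_mod_cast hjk
    refine ⟨?_, h0⟩
    have := hi j (Finset.mem_range.2 hjk)
    rwa [h0] at this
  have hbound : ∀ y, |(ν i : Measure ℝ).real (Set.Iic y) - G y| ≤ ε / 2 := by
    intro y
    have hG0 : 0 ≤ G y := measureReal_nonneg
    have hG1 : G y ≤ 1 := measureReal_le_one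
    have hn0 : 0 ≤ (ν i : Measure ℝ).real (Set.Iic y) := measureReal_nonneg
    have hn1 : (ν i : Measure ℝ).real (Set.Iic y) ≤ 1 := measureReal_le_one
    rw [abs_le]
    constructor
    -- Lower bound: compare with the largest grid quantile strictly below level `G y`, of index `c -
    -- 1`. If `c < 2` there is none, but then `G y ≤ 1 / k` and nonnegativity suffices.
    · set c := ⌈(k : ℝ) * G y⌉₊ with hc
      rcases Nat.lt_or_ge c 2 with hc2 | hc2
      · have : (k : ℝ) * G y ≤ 1 :=
          (Nat.le_ceil _).trans (by exact_mod_cast Nat.lt_succ_iff.1 hc2)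
        have : G y ≤ 1 / k := by rw [le_div_iff₀ hk0]; linarith
        linarith
      · have hcpos : (0 : ℝ) < k * G y := by
          by_contra hneg
          have : c = 0 := Nat.ceil_eq_zero.2 (not_lt.1 hneg)
          omega
        have hlt : ((c - 1 : ℕ) : ℝ) < k * G y := by
          have := Nat.ceil_lt_add_one hcpos.le
          rw [Nat.cast_sub (by omega), Nat.cast_one]
          linarith
        have hle : (k : ℝ) * G y ≤ ((c - 1 : ℕ) : ℝ) + 1 := by
          rw [Nat.cast_sub (by omega), Nat.cast_one]
          linarith [Nat.le_ceil ((k : ℝ) * G y)]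
        have hck : c - 1 < k := by
          have : ((c - 1 : ℕ) : ℝ) < k := hlt.trans_le (by nlinarith)
          exact_mod_cast this
        obtain ⟨h1, h2⟩ := hj (c - 1) (by omega) hck
        have hxy : x (((c - 1 : ℕ) : ℝ) / k) < y := by
          refine hGm.reflect_lt ?_
          rw [h2, div_lt_iff₀ hk0]
          linarith
        have h3 : (ν i : Measure ℝ).real (Set.Iic (x (((c - 1 : ℕ) : ℝ) / k))) ≤
          (ν i : Measure ℝ).real (Set.Iic y) := hmono hxy.le
        have h4 : G y ≤ ((c - 1 : ℕ) : ℝ) / k + 1 / k := by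
          rw [← add_div, le_div_iff₀ hk0]
          linarith
        have := (abs_lt.1 h1).1
        linarith
    -- Upper bound, symmetrically with index `c + 1`; when this reaches `k`, `G y ≥ 1 - 1 / k` and
    -- the trivial bound `1` is enough.
    · set c := ⌊(k : ℝ) * G y⌋₊ with hc
      have hlt : (k : ℝ) * G y < (c : ℝ) + 1 := Nat.lt_floor_add_one _
      have hle : (c : ℝ) ≤ k * G y := Nat.floor_le (by positivity)
      rcases Nat.lt_or_ge (c + 1) k with hck | hck
      · obtain ⟨h1, h2⟩ := hj (c + 1) (by omega) hck
        have hxy : y < x (((c + 1 : ℕ) : ℝ) / k) := by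
          refine hGm.reflect_lt ?_
          rw [h2, lt_div_iff₀ hk0]
          push_cast
          linarith
        have h3 : (ν i : Measure ℝ).real (Set.Iic y) ≤
          (ν i : Measure ℝ).real (Set.Iic (x (((c + 1 : ℕ) : ℝ) / k))) := hmono hxy.le
        have h4 : ((c + 1 : ℕ) : ℝ) / k ≤ G y + 1 / k := by
          rw [div_le_iff₀ hk0, add_mul, div_mul_cancel₀ _ hk0.ne']
          push_cast
          linarith
        have := (abs_lt.1 h1).2
        linarith
      · have h5 : (k : ℝ) ≤ c + 1 := by exact_mod_cast hck
        have h4 : 1 ≤ G y + 1 / k := by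
          have : (k : ℝ) ≤ (G y + 1 / k) * k := by
            rw [add_mul, div_mul_cancel₀ _ hk0.ne']
            linarith
          nlinarith
        linarith
  rw [Real.dist_eq, sub_zero, abs_of_nonneg (kolmogorovDist_nonneg _ _)]
  exact (ciSup_le hbound).trans_lt (by linarith)

/-! ### Convergence of random functionals -/

/-- Sequential convergence amounts to a joint limit along `atTop ×ˢ 𝓝[s] x₀`, so for large `m` the
bad event of `h m (T m ω)` lies in the event that `T m` is `δ`-far from `x₀`. Only monotonicity of
the measure enters, hence no measurability of `h m` is needed. -/
theorem tendstoInMeasure_of_forall_seq {Ω E : Type*} [MeasurableSpace Ω] [PseudoEMetricSpace E]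
    {P : Measure Ω} {T : ℕ → Ω → E} {x₀ : E} {s : Set E} (hx₀ : x₀ ∈ s) (hTs : ∀ m ω, T m ω ∈ s)
    (hT : TendstoInMeasure P T atTop fun _ => x₀) {h : ℕ → E → ℝ} {c : ℝ}
    (hh : ∀ (k : ℕ → ℕ) (x : ℕ → E), Tendsto k atTop atTop → (∀ j, x j ∈ s) →
      Tendsto x atTop (𝓝 x₀) → Tendsto (fun j => h (k j) (x j)) atTop (𝓝 c)) :
    TendstoInMeasure P (fun m ω => h m (T m ω)) atTop fun _ => c := by
  classical
  have hlim : Tendsto (fun p : ℕ × E => h p.1 p.2) (atTop ×ˢ 𝓝[s] x₀) (𝓝 c) := by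
    refine tendsto_of_seq_tendsto fun x hx => ?_
    rw [tendsto_prod_iff'] at hx
    obtain ⟨hx1, hx2⟩ := hx
    rw [tendsto_nhdsWithin_iff] at hx2
    -- The sequence lies in `s` only eventually, while `hh` asks for every index; stray terms are
    -- replaced by `x₀`.
    have hev : (fun j => if (x j).2 ∈ s then (x j).2 else x₀) =ᶠ[atTop] fun j => (x j).2 := by
      filter_upwards [hx2.2] with j hj
      rw [if_pos hj]
    refine (hh (fun j => (x j).1) (fun j => if (x j).2 ∈ s then (x j).2 else x₀) hx1
      (fun j => ?_) (hx2.1.congr' hev.symm)).congr' ?_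
    · split_ifs with hj
      exacts [hj, hx₀]
    · filter_upwards [hx2.2] with j hj
      simp [hj]
  intro ε hε
  have hev : ∀ᶠ p in atTop ×ˢ 𝓝[s] x₀, edist (h p.1 p.2) c < ε :=
    hlim (Metric.eball_mem_nhds c hε)
  rw [eventually_prod_iff] at hev
  obtain ⟨pa, hpa, pb, hpb, hpab⟩ := hev
  rw [eventually_nhdsWithin_iff, Metric.nhds_basis_eball.eventually_iff] at hpb
  obtain ⟨δ, hδ, hball⟩ := hpb
  refine tendsto_of_tendsto_of_tendsto_of_le_of_le' tendsto_const_nhds (hT δ hδ)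
    (Eventually.of_forall fun _ => zero_le) ?_
  filter_upwards [hpa] with m hm
  refine measure_mono fun ω hω => ?_
  by_contra hlt
  simp only [Set.mem_ofPred_eq, not_le] at hlt hω
  exact absurd (hpab hm (hball (Metric.mem_eball.2 hlt) (hTs m ω))) (not_lt.2 hω)

/-! ### The limit law -/

section Limit

open scoped MatrixOrder

variable {a : ℕ} {t : Fin a → ℕ}

/-- Continuity of the square root holds relative to the positive semidefinite cone, which is why all
approximating sequences below are kept inside it. -/
theorem tendsto_cfcSqrt {ι n : Type*} [Fintype n] [DecidableEq n] {l : Filter ι}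
    {S : ι → Matrix n n ℝ} {S₀ : Matrix n n ℝ} (hS : ∀ j, (S j).PosSemidef) (hS₀ : S₀.PosSemidef)
    (h : Tendsto S l (𝓝 S₀)) : Tendsto (fun j => CFC.sqrt (S j)) l (𝓝 (CFC.sqrt S₀)) := by
  open scoped Matrix.Norms.L2Operator in
  have hc := (CFC.continuousOn_sqrt (A := Matrix n n ℝ)) S₀ hS₀.nonneg
  exact hc.tendsto.comp (tendsto_nhdsWithin_iff.2 ⟨h, Eventually.of_forall fun j => (hS j).nonneg⟩)

theorem transpose_cfcSqrt {n : Type*} [Fintype n] [DecidableEq n] (S : Matrix n n ℝ) :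
    (CFC.sqrt S)ᵀ = CFC.sqrt S := by
  have h := (CFC.sqrt_nonneg S).isSelfAdjoint
  rwa [IsSelfAdjoint, star_eq_conjTranspose, conjTranspose_eq_transpose_of_trivial] at h

/-- The limit of the matrix `sigmaHat`. -/
noncomputable def limitCov (κ : Fin a → ℝ) (V : (i : Fin a) → Matrix (Fin (t i)) (Fin (t i)) ℝ) :
    Matrix (Σ i, Fin (t i)) (Σ i, Fin (t i)) ℝ :=
  blockDiagonal' fun i => (κ i)⁻¹ • V i

/-- A square root of `limitCov κ V`. -/
noncomputable def limitFactor (κ : Fin a → ℝ)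
    (V : (i : Fin a) → Matrix (Fin (t i)) (Fin (t i)) ℝ) :
    Matrix (Σ i, Fin (t i)) (Σ i, Fin (t i)) ℝ :=
  blockDiagonal' fun i => √(κ i)⁻¹ • CFC.sqrt (V i)

theorem limitFactor_mul_transpose {κ : Fin a → ℝ} (hκ : ∀ i, 0 < κ i)
    {V : (i : Fin a) → Matrix (Fin (t i)) (Fin (t i)) ℝ} (hV : ∀ i, (V i).PosSemidef) :
    limitFactor κ V * (limitFactor κ V)ᵀ = limitCov κ V := by
  rw [limitFactor, limitCov, blockDiagonal'_transpose, ← blockDiagonal'_mul]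
  congr 1
  ext1 i
  rw [transpose_smul, transpose_cfcSqrt, Matrix.smul_mul, Matrix.mul_smul, smul_smul,
    CFC.sqrt_mul_sqrt_self _ (hV i).nonneg, Real.mul_self_sqrt (inv_nonneg.2 (hκ i).le)]

theorem posDef_limitCov {κ : Fin a → ℝ} (hκ : ∀ i, 0 < κ i)
    {V : (i : Fin a) → Matrix (Fin (t i)) (Fin (t i)) ℝ} (hV : ∀ i, (V i).PosDef) :
    (limitCov κ V).PosDef := by
  have hinv : limitCov κ V * blockDiagonal' (fun i => ((κ i)⁻¹ • V i)⁻¹) = 1 := by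
    rw [limitCov, ← blockDiagonal'_mul, ← blockDiagonal'_one]
    congr 1
    ext1 i
    exact mul_nonsing_inv _ ((hV i).smul (inv_pos.2 (hκ i))).det_pos.ne'.isUnit
  have hpsd : (limitCov κ V).PosSemidef := by
    rw [← limitFactor_mul_transpose hκ fun i => (hV i).posSemidef,
      ← conjTranspose_eq_transpose_of_trivial]
    exact posSemidef_self_mul_conjTranspose _
  exact hpsd.posDef_iff_isUnit.2 (IsUnit.of_mul_eq_one _ hinv)

/-- The limit law of the quadratic statistic with the weight matrix `K`. -/
noncomputable def limitLaw (κ : Fin a → ℝ) (V : (i : Fin a) → Matrix (Fin (t i)) (Fin (t i)) ℝ)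
    (K : Matrix (Σ i, Fin (t i)) (Σ i, Fin (t i)) ℝ →
      Matrix (Σ i, Fin (t i)) (Σ i, Fin (t i)) ℝ) : Measure ℝ :=
  (stdNormal (Σ i, Fin (t i))).map fun u =>
    u ⬝ᵥ (((limitFactor κ V)ᵀ * K (limitCov κ V) * limitFactor κ V) *ᵥ u)

instance isProbabilityMeasure_limitLaw (κ : Fin a → ℝ)
    (V : (i : Fin a) → Matrix (Fin (t i)) (Fin (t i)) ℝ)
    (K : Matrix (Σ i, Fin (t i)) (Σ i, Fin (t i)) ℝ → Matrix (Σ i, Fin (t i)) (Σ i, Fin (t i)) ℝ) :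
    IsProbabilityMeasure (limitLaw κ V K) :=
  Measure.isProbabilityMeasure_map (continuous_quadForm _).measurable.aemeasurable

/-- By cyclicity the trace of the limiting form is that of `K Σ * Σ`, since `limitFactor` is a
square root of `Σ = limitCov κ V`. -/
theorem nullSingletonClass_limitLaw {κ : Fin a → ℝ} (hκ : ∀ i, 0 < κ i)
    {V : (i : Fin a) → Matrix (Fin (t i)) (Fin (t i)) ℝ} (hV : ∀ i, (V i).PosSemidef)
    {K : Matrix (Σ i, Fin (t i)) (Σ i, Fin (t i)) ℝ → Matrix (Σ i, Fin (t i)) (Σ i, Fin (t i)) ℝ}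
    (hK : (K (limitCov κ V) * limitCov κ V).trace ≠ 0) :
    NullSingletonClass (limitLaw κ V K) := by
  refine nullSingletonClass_map_quadForm_stdNormal ?_
  rwa [Matrix.mul_assoc, trace_mul_comm, Matrix.mul_assoc, limitFactor_mul_transpose hκ hV]

@[fun_prop]
theorem measurable_stack :
    Measurable (stack : ((i : Fin a) → EuclideanSpace ℝ (Fin (t i))) → (Σ i, Fin (t i)) → ℝ) := by
  unfold stack
  fun_prop

theorem map_stack_pi_multivariateGaussian (V : (i : Fin a) → Matrix (Fin (t i)) (Fin (t i)) ℝ) :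
    (Measure.pi fun i => multivariateGaussian 0 (V i)).map stack =
      (stdNormal (Σ i, Fin (t i))).map
        fun u => (blockDiagonal' fun i => CFC.sqrt (V i)) *ᵥ u := by
  have h1 : ∀ i, multivariateGaussian 0 (V i) = (Measure.pi fun _ : Fin (t i) =>
      gaussianReal 0 1).map fun x => toEuclideanCLM (𝕜 := ℝ) (CFC.sqrt (V i)) (WithLp.toLp 2 x) := by
    intro i
    rw [multivariateGaussian, ← map_pi_eq_stdGaussian, Measure.map_map (by fun_prop) (by fun_prop)]
    simp [Function.comp_def]
  have h2 := Measure.infinitePi_map_piCurry (X := fun (i : Fin a) (_ : Fin (t i)) => ℝ)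
    fun _ _ => gaussianReal 0 1
  simp only [Measure.infinitePi_eq_pi] at h2
  have h3 : (Measure.pi fun i => multivariateGaussian 0 (V i)) =
      ((Measure.pi fun i => Measure.pi fun _ : Fin (t i) => gaussianReal 0 1)).map fun x i =>
        toEuclideanCLM (𝕜 := ℝ) (CFC.sqrt (V i)) (WithLp.toLp 2 (x i)) := by
    have : ∀ i, IsProbabilityMeasure ((Measure.pi fun _ : Fin (t i) => gaussianReal 0 1).map
        fun x => toEuclideanCLM (𝕜 := ℝ) (CFC.sqrt (V i)) (WithLp.toLp 2 x)) := fun i =>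
      Measure.isProbabilityMeasure_map (by fun_prop)
    simp only [h1]
    exact (Measure.pi_map_pi (μ := fun i => Measure.pi fun _ : Fin (t i) => gaussianReal 0 1)
      (f := fun i x => toEuclideanCLM (𝕜 := ℝ) (CFC.sqrt (V i)) (WithLp.toLp 2 x))
      (fun i => by fun_prop)).symm
  rw [h3, ← h2, Measure.map_map (by fun_prop) (by fun_prop), Measure.map_map (by fun_prop)
    (by fun_prop)]
  congr 1
  ext u p
  have := congrFun (blockDiagonal'_mulVec_stack (fun i => CFC.sqrt (V i))
    fun i => WithLp.toLp 2 fun s => u ⟨i, s⟩) p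
  exact this.symm

theorem mulVec_dotProduct_mulVec_mulVec {m n : Type*} [Fintype m] [Fintype n]
    (M : Matrix m n ℝ) (A : Matrix m m ℝ) (u : n → ℝ) :
    (M *ᵥ u) ⬝ᵥ (A *ᵥ (M *ᵥ u)) = u ⬝ᵥ ((Mᵀ * A * M) *ᵥ u) := by
  rw [← mulVec_mulVec, ← mulVec_mulVec, dotProduct_mulVec u, vecMul_transpose]

/-- Identifies the two limits: `W = V`, `R = 1` is the original data, and `W = 1`, `R = CFC.sqrt V`
is the bootstrap. -/
theorem map_quadForm_pi_multivariateGaussian {κ : Fin a → ℝ}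
    {V W R : (i : Fin a) → Matrix (Fin (t i)) (Fin (t i)) ℝ}
    (hR : ∀ i, R i * CFC.sqrt (W i) = CFC.sqrt (V i))
    (K : Matrix (Σ i, Fin (t i)) (Σ i, Fin (t i)) ℝ → Matrix (Σ i, Fin (t i)) (Σ i, Fin (t i)) ℝ) :
    (Measure.pi fun i => multivariateGaussian 0 (W i)).map
      (fun z => stack z ⬝ᵥ (((blockDiagonal' fun i => √(κ i)⁻¹ • R i)ᵀ * K (limitCov κ V) *
        blockDiagonal' fun i => √(κ i)⁻¹ • R i) *ᵥ stack z)) = limitLaw κ V K := by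
  have hΔ : limitFactor κ V = (blockDiagonal' fun i => √(κ i)⁻¹ • R i) *
      blockDiagonal' fun i => CFC.sqrt (W i) := by
    rw [← blockDiagonal'_mul, limitFactor]
    simp only [Matrix.smul_mul, hR]
  have hm := (continuous_quadForm ((blockDiagonal' fun i => √(κ i)⁻¹ • R i)ᵀ * K (limitCov κ V) *
    blockDiagonal' fun i => √(κ i)⁻¹ • R i)).measurable
  have h := Measure.map_map (μ := Measure.pi fun i => multivariateGaussian 0 (W i)) hm
    measurable_stack
  rw [Function.comp_def] at h
  have hB : Measurable fun u => (blockDiagonal' fun i => CFC.sqrt (W i)) *ᵥ u :=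
    (continuous_const.matrix_mulVec continuous_id).measurable
  rw [← h, map_stack_pi_multivariateGaussian, Measure.map_map hm hB, limitLaw, hΔ]
  congr 1
  ext u
  simp only [Function.comp_apply]
  rw [mulVec_dotProduct_mulVec_mulVec]
  simp only [transpose_mul, Matrix.mul_assoc]

end Limit

/-! ### The parametric bootstrap -/

section Bootstrap

open scoped MatrixOrder

variable {a : ℕ} {t : Fin a → ℕ}

/-- The law of independent centered normal samples with covariance matrices `S i`. -/
noncomputable def normalSampleLaw (n : Fin a → ℕ)
    (S : (i : Fin a) → Matrix (Fin (t i)) (Fin (t i)) ℝ) : Measure (Sample t n) :=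
  Measure.pi fun i => Measure.pi fun _ => multivariateGaussian 0 (S i)

instance isProbabilityMeasure_normalSampleLaw (n : Fin a → ℕ)
    (S : (i : Fin a) → Matrix (Fin (t i)) (Fin (t i)) ℝ) :
    IsProbabilityMeasure (normalSampleLaw n S) := by
  unfold normalSampleLaw
  infer_instance

theorem bootLaw_eq_normalSampleLaw {n : Fin a → ℕ} (y : Sample t n) :
    bootLaw y = normalSampleLaw n (sampleCov y) := rfl

/-- Moves the dependence on `S` from the law of the sample into a linear map, so that one fixed
standard normal model serves all `S`. -/
theorem normalSampleLaw_eq_map_transform (n : Fin a → ℕ)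
    (S : (i : Fin a) → Matrix (Fin (t i)) (Fin (t i)) ℝ) :
    normalSampleLaw n S =
      (normalSampleLaw n fun _ => 1).map (transform fun i => CFC.sqrt (S i)) := by
  have h1 : ∀ i, multivariateGaussian 0 (S i) = (multivariateGaussian 0 1).map
      fun x => toEuclideanCLM (𝕜 := ℝ) (CFC.sqrt (S i)) x := by
    intro i
    rw [multivariateGaussian_zero_one, multivariateGaussian]
    simp only [zero_add]
  have hp : ∀ i, IsProbabilityMeasure ((multivariateGaussian 0 1).map
      fun x => toEuclideanCLM (𝕜 := ℝ) (CFC.sqrt (S i)) x) := fun i =>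
    Measure.isProbabilityMeasure_map (by fun_prop)
  have h2 : ∀ i, (Measure.pi fun _ : Fin (n i) => multivariateGaussian 0 (S i)) =
      (Measure.pi fun _ : Fin (n i) => multivariateGaussian 0 1).map
        fun x k => toEuclideanCLM (𝕜 := ℝ) (CFC.sqrt (S i)) (x k) := by
    intro i
    rw [h1 i]
    exact (Measure.pi_map_pi (μ := fun _ : Fin (n i) => multivariateGaussian 0 1)
      (f := fun _ x => toEuclideanCLM (𝕜 := ℝ) (CFC.sqrt (S i)) x) (fun _ => by fun_prop)).symm
  have hmeas : ∀ i, Measurable fun (x : Fin (n i) → EuclideanSpace ℝ (Fin (t i))) k =>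
      toEuclideanCLM (𝕜 := ℝ) (CFC.sqrt (S i)) (x k) := fun i => measurable_pi_lambda _ fun k =>
    (toEuclideanCLM (𝕜 := ℝ) (CFC.sqrt (S i))).continuous.measurable.comp (measurable_pi_apply k)
  have hp2 : ∀ i, IsProbabilityMeasure ((Measure.pi fun _ : Fin (n i) =>
      multivariateGaussian 0 1).map
        fun x k => toEuclideanCLM (𝕜 := ℝ) (CFC.sqrt (S i)) (x k)) := fun i =>
    Measure.isProbabilityMeasure_map (hmeas i).aemeasurable
  rw [normalSampleLaw, normalSampleLaw]
  simp only [h2]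
  exact (Measure.pi_map_pi (μ := fun i => Measure.pi fun _ : Fin (n i) => multivariateGaussian 0 1)
    (f := fun i x k => toEuclideanCLM (𝕜 := ℝ) (CFC.sqrt (S i)) (x k)) (fun i => (hmeas i).aemeasurable)).symm

/-- A quadratic statistic whose weight matrix depends measurably on the data, continuously on the
covariance matrix at the limit, and which is invariant under shifts in the kernel of `H`. -/
structure IsRegularWeight {r : ℕ} (H : Matrix (Fin r) (Σ i, Fin (t i)) ℝ)
    (S₀ : Matrix (Σ i, Fin (t i)) (Σ i, Fin (t i)) ℝ)
    (K : Matrix (Σ i, Fin (t i)) (Σ i, Fin (t i)) ℝ →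
      Matrix (Σ i, Fin (t i)) (Σ i, Fin (t i)) ℝ) : Prop where
  factor : ∃ X : Matrix (Σ i, Fin (t i)) (Σ i, Fin (t i)) ℝ → Matrix (Fin r) (Fin r) ℝ,
    ∀ S, K S = Hᵀ * X S * H
  measurable : ∀ (n : Fin a → ℕ) (p q), Measurable fun y : Sample t n => K (sigmaHat y) p q
  continuousAt : ContinuousAt K S₀

variable {r : ℕ} {H : Matrix (Fin r) (Σ i, Fin (t i)) ℝ}
  {K : Matrix (Σ i, Fin (t i)) (Σ i, Fin (t i)) ℝ → Matrix (Σ i, Fin (t i)) (Σ i, Fin (t i)) ℝ}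
  {V : (i : Fin a) → Matrix (Fin (t i)) (Fin (t i)) ℝ} {κ : Fin a → ℝ} {n : ℕ → Fin a → ℕ}

theorem IsRegularWeight.isProbabilityMeasure_map
    {S₀ : Matrix (Σ i, Fin (t i)) (Σ i, Fin (t i)) ℝ} (hK : IsRegularWeight H S₀ K)
    {n : Fin a → ℕ} (ν : Measure (Sample t n)) [IsProbabilityMeasure ν] :
    IsProbabilityMeasure (ν.map (quadStat K)) :=
  Measure.isProbabilityMeasure_map (measurable_quadStat (hK.measurable n)).aemeasurable

theorem IsRegularWeight.tendsto_map_observed (hK : IsRegularWeight H (limitCov κ V) K)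
    {Ω : Type*} [MeasurableSpace Ω] {P : Measure Ω} [IsProbabilityMeasure P]
    {Y : (i : Fin a) → ℕ → Ω → EuclideanSpace ℝ (Fin (t i))}
    {F : (i : Fin a) → Measure (EuclideanSpace ℝ (Fin (t i)))}
    {μ : (i : Fin a) → EuclideanSpace ℝ (Fin (t i))}
    (hY : IsModel P Y F μ V) (hμ : H *ᵥ stack μ = 0) (hV : ∀ i, (V i).PosSemidef)
    (hn : ∀ i, Tendsto (fun m => n m i) atTop atTop) (hκ : ∀ i, 0 < κ i)
    (hnκ : ∀ i, Tendsto (fun m => (n m i : ℝ) / (totalSize (n m) : ℝ)) atTop (𝓝 (κ i)))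
    (hp : ∀ m, IsProbabilityMeasure (P.map fun ω => quadStat K (observed Y (n m) ω))) :
    Tendsto (β := ProbabilityMeasure ℝ)
      (fun m => ⟨P.map fun ω => quadStat K (observed Y (n m) ω), hp m⟩) atTop
      (𝓝 ⟨limitLaw κ V K, inferInstance⟩) := by
  obtain ⟨X, hX⟩ := hK.factor
  have hone : (blockDiagonal' fun i => (κ i)⁻¹ • ((1 : Matrix (Fin (t i)) (Fin (t i)) ℝ) * V i * 1ᵀ)) =
      limitCov κ V := by
    simp [limitCov]
  have h := hY.tendstoInDistribution_quadStat hV hn hκ hnκ (R := fun _ _ => 1) (R₀ := fun _ => 1)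
    (fun i => tendsto_const_nhds) hX (fun m => by simpa using hμ) hK.measurable
    (by rw [hone]; exact hK.continuousAt)
  have hlaw := map_quadForm_pi_multivariateGaussian (κ := κ) (V := V) (W := V) (R := fun _ => 1)
    (fun i => Matrix.one_mul _) K
  have ht : ∀ (n : Fin a → ℕ) (y : Sample t n), transform (fun _ => 1) y = y := by
    intro n y
    ext i k s
    simp [transform]
  have h' := h.tendsto
  simp only [hone, hlaw, ht] at h'
  exact h'

/-- The deterministic core of the bootstrap: the general limit theorem with `R m = CFC.sqrt (S m)`,
applied to a standard normal array. The mean is zero, so the condition on `H` is automatic. -/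
theorem IsRegularWeight.tendsto_map_normalSampleLaw (hK : IsRegularWeight H (limitCov κ V) K)
    (hV : ∀ i, (V i).PosSemidef) (hn : ∀ i, Tendsto (fun m => n m i) atTop atTop)
    (hκ : ∀ i, 0 < κ i)
    (hnκ : ∀ i, Tendsto (fun m => (n m i : ℝ) / (totalSize (n m) : ℝ)) atTop (𝓝 (κ i)))
    {S : ℕ → (i : Fin a) → Matrix (Fin (t i)) (Fin (t i)) ℝ} (hS : ∀ m i, (S m i).PosSemidef)
    (hSV : ∀ i, Tendsto (fun m => S m i) atTop (𝓝 (V i))) :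
    Tendsto (β := ProbabilityMeasure ℝ)
      (fun m => ⟨(normalSampleLaw (n m) (S m)).map (quadStat K),
        hK.isProbabilityMeasure_map _⟩) atTop
      (𝓝 ⟨limitLaw κ V K, inferInstance⟩) := by
  obtain ⟨X, hX⟩ := hK.factor
  -- A single infinite array supplies the samples of every size.
  obtain ⟨Ω, mΩ, P, Z, hZm, hZlaw, hZind, hP⟩ := exists_hasLaw_indepFun
    (fun p : Fin a × ℕ => EuclideanSpace ℝ (Fin (t p.1))) fun p => multivariateGaussian 0 1
  have hZ : IsModel P (fun i k => Z (i, k)) (fun i => multivariateGaussian 0 1) (fun _ => 0)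
      (fun i => (1 : Matrix (Fin (t i)) (Fin (t i)) ℝ)) :=
    { indep := hZind
      law := fun i k => hZlaw (i, k)
      moment := fun i => IsGaussian.memLp_id _ 4 (by norm_num)
      mean := fun i => integral_id_multivariateGaussian
      cov := fun i s s' => covariance_eval_multivariateGaussian PosSemidef.one s s' }
  have hcov : (blockDiagonal' fun i => (κ i)⁻¹ • (CFC.sqrt (V i) * 1 * (CFC.sqrt (V i))ᵀ)) =
      limitCov κ V := by
    rw [limitCov]
    congr 1
    ext1 i
    rw [Matrix.mul_one, transpose_cfcSqrt, CFC.sqrt_mul_sqrt_self _ (hV i).nonneg]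
  have h := hZ.tendstoInDistribution_quadStat (fun i => PosSemidef.one) hn hκ hnκ
    (R := fun m i => CFC.sqrt (S m i)) (R₀ := fun i => CFC.sqrt (V i))
    (fun i => tendsto_cfcSqrt (fun m => hS m i) (hV i) (hSV i)) hX
    (fun m => by
      have : stack (fun i => toEuclideanCLM (𝕜 := ℝ) (CFC.sqrt (S m i))
          (0 : EuclideanSpace ℝ (Fin (t i)))) = 0 := by
        ext p; simp [stack]
      rw [this, mulVec_zero]) hK.measurable (by rw [hcov]; exact hK.continuousAt)
  have hlaw := map_quadForm_pi_multivariateGaussian (κ := κ) (V := V) (W := fun _ => 1)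
    (R := fun i => CFC.sqrt (V i)) (fun i => by
        rw [CFC.sqrt_one, Matrix.mul_one]) K
  have h' := h.tendsto
  simp only [hcov, hlaw] at h'
  refine h'.congr fun m => Subtype.ext ?_
  have hobs : P.map (observed (fun i k => Z (i, k)) (n m)) = normalSampleLaw (n m) fun _ => 1 :=
    map_observed_eq_pi hZind (fun i k => hZlaw (i, k)) (n m)
  have hom : AEMeasurable (observed (fun i k => Z (i, k)) (n m)) P :=
    aemeasurable_observed (fun i k => (hZm (i, k)).aemeasurable) (n m)
  change P.map _ = (normalSampleLaw (n m) (S m)).map (quadStat K)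
  rw [normalSampleLaw_eq_map_transform, ← hobs, AEMeasurable.map_map_of_aemeasurable
    (by fun_prop) hom, AEMeasurable.map_map_of_aemeasurable
    (measurable_quadStat (hK.measurable _)).aemeasurable
    ((measurable_transform _).comp_aemeasurable hom)]
  rfl

variable {Ω : Type*} [MeasurableSpace Ω] {P : Measure Ω} [IsProbabilityMeasure P]
  {Y : (i : Fin a) → ℕ → Ω → EuclideanSpace ℝ (Fin (t i))}
  {F : (i : Fin a) → Measure (EuclideanSpace ℝ (Fin (t i)))}
  {μ : (i : Fin a) → EuclideanSpace ℝ (Fin (t i))}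

/-- Functionals of the sample covariance matrices that converge along all deterministic sequences
converge in probability. -/
theorem IsModel.tendstoInMeasure_comp_sampleCov (hY : IsModel P Y F μ V)
    (hV : ∀ i, (V i).PosSemidef) (hn : ∀ i, Tendsto (fun m => n m i) atTop atTop)
    {h : ℕ → ((i : Fin a) → Matrix (Fin (t i)) (Fin (t i)) ℝ) → ℝ} {c : ℝ}
    (hh : ∀ (k : ℕ → ℕ) (S : ℕ → (i : Fin a) → Matrix (Fin (t i)) (Fin (t i)) ℝ),
      Tendsto k atTop atTop → (∀ j i, (S j i).PosSemidef) →
      (∀ i, Tendsto (fun j => S j i) atTop (𝓝 (V i))) →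
      Tendsto (fun j => h (k j) (S j)) atTop (𝓝 c)) :
    TendstoInMeasure P (fun m ω => h m (sampleCov (observed Y (n m) ω))) atTop fun _ => c := by
  let E : Type := (i : Fin a) → Fin (t i) → Fin (t i) → ℝ
  let T : ℕ → Ω → E := fun m ω i => sampleCov (observed Y (n m) ω) i
  have hTm : ∀ m, AEMeasurable (T m) P := by
    intro m
    let T' : Sample t (n m) → E := fun y i => sampleCov y i
    have : Measurable T' :=
      measurable_pi_lambda _ fun i => measurable_pi_lambda _ fun s => measurable_pi_lambda _
        fun s' => measurable_sampleCov i s s'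
    exact this.comp_aemeasurable
      (aemeasurable_observed (fun i k => (hY.law i k).aemeasurable) (n m))
  have hT : TendstoInMeasure P T atTop fun _ => (fun i => V i : E) := by
    refine tendstoInMeasure_of_tendsto_ae (fun m => (hTm m).aestronglyMeasurable) ?_
    filter_upwards [hY.ae_tendsto_sampleCov hn] with ω hω
    exact tendsto_pi_nhds.2 fun i => hω i
  -- Sample covariances are always positive semidefinite, so only sequences in that cone have to be
  -- tested.
  exact tendstoInMeasure_of_forall_seq (E := E) (T := T) (x₀ := fun i => V i)
    (s := {S | ∀ i, (Matrix.of (S i)).PosSemidef}) hV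
    (fun m ω i => posSemidef_sampleCov _ i) hT (h := h)
    fun k S hk hS hSV => hh k S hk hS fun i => (tendsto_pi_nhds.1 hSV) i

theorem IsRegularWeight.tendstoWeaklyInProbability_bootLaw
    (hK : IsRegularWeight H (limitCov κ V) K) (hY : IsModel P Y F μ V)
    (hV : ∀ i, (V i).PosSemidef) (hn : ∀ i, Tendsto (fun m => n m i) atTop atTop)
    (hκ : ∀ i, 0 < κ i)
    (hnκ : ∀ i, Tendsto (fun m => (n m i : ℝ) / (totalSize (n m) : ℝ)) atTop (𝓝 (κ i))) :
    TendstoWeaklyInProbability P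
      (fun m ω => (bootLaw (observed Y (n m) ω)).map (quadStat K)) (limitLaw κ V K) := by
  intro g
  refine hY.tendstoInMeasure_comp_sampleCov hV hn
    (h := fun m S => ∫ x, g x ∂((normalSampleLaw (n m) S).map (quadStat K)))
    fun k S hk hS hSV => ?_
  have h := hK.tendsto_map_normalSampleLaw hV (n := fun j => n (k j))
    (fun i => (hn i).comp hk) hκ (fun i => (hnκ i).comp hk) hS hSV
  exact ProbabilityMeasure.tendsto_iff_forall_integral_tendsto.1 h g

/-- The bootstrap law and the null law are each close to `limitLaw` by Pólya's theorem; the null law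
is deterministic, so only the former needs the passage through sample covariances. -/
theorem IsRegularWeight.tendstoInMeasure_kolmogorovDist
    (hK : IsRegularWeight H (limitCov κ V) K) (hY : IsModel P Y F μ V)
    (hV : ∀ i, (V i).PosSemidef) (hn : ∀ i, Tendsto (fun m => n m i) atTop atTop)
    (hκ : ∀ i, 0 < κ i)
    (hnκ : ∀ i, Tendsto (fun m => (n m i : ℝ) / (totalSize (n m) : ℝ)) atTop (𝓝 (κ i)))
    [NullSingletonClass (limitLaw κ V K)]
    {Ω₀ : Type*} [MeasurableSpace Ω₀] {P₀ : Measure Ω₀} [IsProbabilityMeasure P₀]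
    {Y₀ : (i : Fin a) → ℕ → Ω₀ → EuclideanSpace ℝ (Fin (t i))}
    {F₀ : (i : Fin a) → Measure (EuclideanSpace ℝ (Fin (t i)))}
    {μ₀ : (i : Fin a) → EuclideanSpace ℝ (Fin (t i))}
    (hY₀ : IsModel P₀ Y₀ F₀ μ₀ V) (hμ₀ : H *ᵥ stack μ₀ = 0) :
    TendstoInMeasure P
      (fun m ω => kolmogorovDist ((bootLaw (observed Y (n m) ω)).map (quadStat K))
        (P₀.map fun ω₀ => quadStat K (observed Y₀ (n m) ω₀))) atTop fun _ => 0 := by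
  have hp : ∀ m, IsProbabilityMeasure (P₀.map fun ω => quadStat K (observed Y₀ (n m) ω)) :=
    fun m => Measure.isProbabilityMeasure_map
      ((measurable_quadStat (hK.measurable _)).comp_aemeasurable
        (aemeasurable_observed (fun i k => (hY₀.law i k).aemeasurable) (n m)))
  have h₀ := tendsto_kolmogorovDist
    (hK.tendsto_map_observed hY₀ hμ₀ hV hn hκ hnκ hp)
  refine hY.tendstoInMeasure_comp_sampleCov hV hn
    (h := fun m S => kolmogorovDist ((normalSampleLaw (n m) S).map (quadStat K))
      (P₀.map fun ω₀ => quadStat K (observed Y₀ (n m) ω₀)))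
    fun k S hk hS hSV => ?_
  have h := tendsto_kolmogorovDist (hK.tendsto_map_normalSampleLaw hV (n := fun j => n (k j))
    (fun i => (hn i).comp hk) hκ (fun i => (hnκ i).comp hk) hS hSV)
  have hsum := h.add (h₀.comp hk)
  rw [add_zero] at hsum
  refine squeeze_zero (fun j => kolmogorovDist_nonneg _ _) (fun j => ?_) hsum
  have := hK.isProbabilityMeasure_map (normalSampleLaw (n (k j)) (S j))
  have := hp (k j)
  exact kolmogorovDist_le_add _ _ (limitLaw κ V K)

end Bootstrap

/-! ### The Wald-type and the ANOVA-type statistic -/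

section Statistics

variable {a r : ℕ} {t : Fin a → ℕ}

/-- The weight matrix of the Wald-type statistic. -/
noncomputable def waldWeight (H : Matrix (Fin r) (Σ i, Fin (t i)) ℝ)
    (S : Matrix (Σ i, Fin (t i)) (Σ i, Fin (t i)) ℝ) :
    Matrix (Σ i, Fin (t i)) (Σ i, Fin (t i)) ℝ :=
  Hᵀ * pinv (H * S * Hᵀ) * H

/-- The weight matrix of the ANOVA-type statistic. -/
noncomputable def anovaWeight (H : Matrix (Fin r) (Σ i, Fin (t i)) ℝ)
    (G : Matrix (Fin r) (Fin r) ℝ) (S : Matrix (Σ i, Fin (t i)) (Σ i, Fin (t i)) ℝ) :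
    Matrix (Σ i, Fin (t i)) (Σ i, Fin (t i)) ℝ :=
  Hᵀ * ((Hᵀ * G * H * S).trace⁻¹ • G) * H

theorem WTS_eq_quadStat (H : Matrix (Fin r) (Σ i, Fin (t i)) ℝ) {n : Fin a → ℕ} :
    (WTS H : Sample t n → ℝ) = quadStat (waldWeight H) := rfl

theorem ATS_eq_quadStat (H : Matrix (Fin r) (Σ i, Fin (t i)) ℝ) (G : Matrix (Fin r) (Fin r) ℝ)
    {n : Fin a → ℕ} : (ATS H G : Sample t n → ℝ) = quadStat (anovaWeight H G) := by
  ext y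
  rw [ATS, quadStat, anovaWeight, Matrix.mul_smul, Matrix.smul_mul, smul_mulVec, dotProduct_smul,
    smul_eq_mul, div_eq_mul_inv, mul_assoc]

variable {H : Matrix (Fin r) (Σ i, Fin (t i)) ℝ} {S₀ : Matrix (Σ i, Fin (t i)) (Σ i, Fin (t i)) ℝ}

theorem isRegularWeight_waldWeight (hS₀ : S₀.PosDef) : IsRegularWeight H S₀ (waldWeight H) where
  factor := ⟨_, fun _ => rfl⟩
  measurable n := measurable_const_mul_mul_const _ _ (measurable_pinv
    (measurable_const_mul_mul_const _ _ measurable_sigmaHat) fun y => by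
      rw [transpose_mul, transpose_mul, transpose_transpose, sigmaHat_transpose, Matrix.mul_assoc])
  continuousAt := continuousAt_transpose_mul_pinv_mul H hS₀

/-- The limit law of the Wald-type statistic is chi-squared. -/
theorem limitLaw_waldWeight {κ : Fin a → ℝ} (hκ : ∀ i, 0 < κ i)
    {V : (i : Fin a) → Matrix (Fin (t i)) (Fin (t i)) ℝ} (hV : ∀ i, (V i).PosDef) :
    limitLaw κ V (waldWeight H) = chiSquared H.rank := by
  obtain ⟨B, C, L, R, hH, hL, hR⟩ := exists_rank_factorization H
  have hM : (C * limitCov κ V * Cᵀ).PosDef :=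
    PosDef.mul_mul_transpose_of_rightInverse hR (posDef_limitCov hκ hV)
  -- `W` whitens `C Σ Cᵀ`; therefore `W * C * limitFactor κ V` has orthonormal rows and the limiting
  -- form is the squared norm of `H.rank` standard normals.
  obtain ⟨W, hW, hMW⟩ := PosDef.exists_isUnit_transpose_mul_self hM.inv
  have hdet : IsUnit (C * limitCov κ V * Cᵀ).det := hM.det_pos.ne'.isUnit
  have hWM : W * (C * limitCov κ V * Cᵀ) * Wᵀ = 1 := by
    have h1 : Wᵀ * (W * (C * limitCov κ V * Cᵀ)) = 1 := by
      rw [← Matrix.mul_assoc, ← hMW, nonsing_inv_mul _ hdet]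
    exact mul_eq_one_comm.1 h1
  have hK : waldWeight H (limitCov κ V) = Cᵀ * (Wᵀ * W) * C := by
    rw [← hMW]
    exact transpose_mul_genInverse_mul_of_factor hH hL hdet
      (isMoorePenrose_pinv _).mul_mul_left
  have hB : (W * C * limitFactor κ V) * (W * C * limitFactor κ V)ᵀ = 1 := by
    calc (W * C * limitFactor κ V) * (W * C * limitFactor κ V)ᵀ
        = W * (C * (limitFactor κ V * (limitFactor κ V)ᵀ) * Cᵀ) * Wᵀ := by
          simp only [transpose_mul, Matrix.mul_assoc]
      _ = 1 := by rw [limitFactor_mul_transpose hκ fun i => (hV i).posSemidef, hWM]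
  rw [← map_quadForm_stdNormal_eq_chiSquared hB, limitLaw, hK]
  simp only [transpose_mul, Matrix.mul_assoc]

/-- Cyclicity collapses the product to the identity of size `H.rank`. A nonzero rank therefore
excludes atoms in the Wald limit. -/
theorem trace_waldWeight_mul (hS₀ : S₀.PosDef) : (waldWeight H S₀ * S₀).trace = H.rank := by
  obtain ⟨B, C, L, R, hH, hL, hR⟩ := exists_rank_factorization H
  have hdet : IsUnit (C * S₀ * Cᵀ).det :=
    (PosDef.mul_mul_transpose_of_rightInverse hR hS₀).det_pos.ne'.isUnit
  have hK : waldWeight H S₀ = Cᵀ * (C * S₀ * Cᵀ)⁻¹ * C :=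
    transpose_mul_genInverse_mul_of_factor hH hL hdet (isMoorePenrose_pinv _).mul_mul_left
  rw [hK, Matrix.mul_assoc, Matrix.mul_assoc, trace_mul_comm, Matrix.mul_assoc,
    nonsing_inv_mul _ hdet, trace_one, Fintype.card_fin]

/-- The projection equals `Cᵀ (C Cᵀ)⁻¹ C`; splitting the inverse as `Wᵀ W` rewrites the trace as
that of a positive definite matrix of size `H.rank`. Thus the ANOVA-type denominator has a nonzero
limit. -/
theorem trace_projection_mul_pos (hr : H.rank ≠ 0) {G : Matrix (Fin r) (Fin r) ℝ}
    (hG : IsGenInverse (H * Hᵀ) G) (hS₀ : S₀.PosDef) : 0 < (Hᵀ * G * H * S₀).trace := by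
  obtain ⟨B, C, L, R, hH, hL, hR⟩ := exists_rank_factorization H
  have hC : (C * (1 : Matrix (Σ i, Fin (t i)) (Σ i, Fin (t i)) ℝ) * Cᵀ).PosDef := PosDef.mul_mul_transpose_of_rightInverse hR PosDef.one
  have hM : (C * S₀ * Cᵀ).PosDef := PosDef.mul_mul_transpose_of_rightInverse hR hS₀
  have hT : Hᵀ * G * H = Cᵀ * (C * (1 : Matrix (Σ i, Fin (t i)) (Σ i, Fin (t i)) ℝ) * Cᵀ)⁻¹ * C :=
    transpose_mul_genInverse_mul_of_factor hH hL hC.det_pos.ne'.isUnit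
      (by rw [Matrix.mul_one]; exact hG)
  obtain ⟨W, hW, hCW⟩ := PosDef.exists_isUnit_transpose_mul_self hC.inv
  have htr : (Hᵀ * G * H * S₀).trace = (W * (C * S₀ * Cᵀ) * Wᵀ).trace := by
    rw [hT, hCW]
    calc (Cᵀ * (Wᵀ * W) * C * S₀).trace = ((Cᵀ * Wᵀ) * (W * C * S₀)).trace := by
          simp only [Matrix.mul_assoc]
      _ = (W * (C * S₀ * Cᵀ) * Wᵀ).trace := by
          rw [trace_mul_comm]
          simp only [Matrix.mul_assoc]
  have hWinv : W * W⁻¹ = 1 := mul_nonsing_inv _ ((isUnit_iff_isUnit_det _).1 hW)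
  have : Nonempty (Fin H.rank) := ⟨⟨0, Nat.pos_of_ne_zero hr⟩⟩
  rw [htr]
  exact (PosDef.mul_mul_transpose_of_rightInverse hWinv hM).trace_pos

theorem anovaWeight_eq_smul (G : Matrix (Fin r) (Fin r) ℝ)
    (S : Matrix (Σ i, Fin (t i)) (Σ i, Fin (t i)) ℝ) :
    anovaWeight H G S = (Hᵀ * G * H * S).trace⁻¹ • (Hᵀ * G * H) := by
  rw [anovaWeight, Matrix.mul_smul, Matrix.smul_mul]

theorem trace_anovaWeight_mul {G : Matrix (Fin r) (Fin r) ℝ}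
    (h : (Hᵀ * G * H * S₀).trace ≠ 0) : (anovaWeight H G S₀ * S₀).trace = 1 := by
  rw [anovaWeight_eq_smul, Matrix.smul_mul, trace_smul, smul_eq_mul, inv_mul_cancel₀ h]

theorem isRegularWeight_anovaWeight {G : Matrix (Fin r) (Fin r) ℝ}
    (h : (Hᵀ * G * H * S₀).trace ≠ 0) : IsRegularWeight H S₀ (anovaWeight H G) where
  factor := ⟨_, fun _ => rfl⟩
  measurable n p q := by
    simp only [anovaWeight_eq_smul, Matrix.smul_apply, smul_eq_mul]
    refine Measurable.mul_const (Measurable.inv ?_) _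
    exact Finset.measurable_sum _ fun p _ =>
      measurable_matrix_mul (A := fun _ => Hᵀ * G * H) (fun _ _ => measurable_const)
        measurable_sigmaHat p p
  continuousAt := by
    simp only [funext fun S => anovaWeight_eq_smul (H := H) G S]
    have hc : Continuous fun S : Matrix (Σ i, Fin (t i)) (Σ i, Fin (t i)) ℝ =>
        (Hᵀ * G * H * S).trace := by fun_prop
    exact (hc.continuousAt.inv₀ h).smul continuousAt_const

theorem kolmogorovDist_map_const {Ω Ω' : Type*} [MeasurableSpace Ω] [MeasurableSpace Ω']
    (P : Measure Ω) (P' : Measure Ω') [IsProbabilityMeasure P] [IsProbabilityMeasure P'] (c : ℝ) :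
    kolmogorovDist (P.map fun _ => c) (P'.map fun _ => c) = 0 := by
  rw [Measure.map_const, Measure.map_const, measure_univ, measure_univ, kolmogorovDist_self]

end Statistics

end ParamBoot

theorem theorem9p2 {a r : ℕ} {t : Fin a → ℕ}
    -- contrast matrix, and a generalized inverse of `H * Hᵀ`
    (H : Matrix (Fin r) (Σ i, Fin (t i)) ℝ) (hH : ∀ j, ∑ p, H j p = 0)
    (G : Matrix (Fin r) (Fin r) ℝ) (hG : ParamBoot.IsGenInverse (H * Hᵀ) G)
    -- covariance matrices of the groups
    (V : (i : Fin a) → Matrix (Fin (t i)) (Fin (t i)) ℝ) (hV : ∀ i, (V i).PosDef)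
    -- data under the mean vector `μ`
    {Ω : Type*} [MeasurableSpace Ω] (P : Measure Ω) [IsProbabilityMeasure P]
    (Y : (i : Fin a) → ℕ → Ω → EuclideanSpace ℝ (Fin (t i)))
    (F : (i : Fin a) → Measure (EuclideanSpace ℝ (Fin (t i))))
    (μ : (i : Fin a) → EuclideanSpace ℝ (Fin (t i)))
    (hY : ParamBoot.IsModel P Y F μ V)
    -- data under a mean vector `μ₀` in the null hypothesis
    {Ω₀ : Type*} [MeasurableSpace Ω₀] (P₀ : Measure Ω₀) [IsProbabilityMeasure P₀]
    (Y₀ : (i : Fin a) → ℕ → Ω₀ → EuclideanSpace ℝ (Fin (t i)))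
    (F₀ : (i : Fin a) → Measure (EuclideanSpace ℝ (Fin (t i))))
    (μ₀ : (i : Fin a) → EuclideanSpace ℝ (Fin (t i)))
    (hY₀ : ParamBoot.IsModel P₀ Y₀ F₀ μ₀ V)
    (hμ₀ : H *ᵥ ParamBoot.stack μ₀ = 0)
    -- group sizes along the asymptotics
    (n : ℕ → Fin a → ℕ) (hn : ∀ i, Tendsto (fun m => n m i) atTop atTop)
    (κ : Fin a → ℝ) (hκ : ∀ i, 0 < κ i)
    (hnκ : ∀ i, Tendsto (fun m => (n m i : ℝ) / (ParamBoot.totalSize (n m) : ℝ))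
      atTop (𝓝 (κ i))) :
    ParamBoot.TendstoWeaklyInProbability P
        (fun m ω => (ParamBoot.bootLaw (ParamBoot.observed Y (n m) ω)).map (ParamBoot.WTS H))
        (ParamBoot.chiSquared H.rank) ∧
      TendstoInMeasure P
        (fun m ω => ParamBoot.kolmogorovDist
          ((ParamBoot.bootLaw (ParamBoot.observed Y (n m) ω)).map (ParamBoot.WTS H))
          (P₀.map fun ω₀ => ParamBoot.WTS H (ParamBoot.observed Y₀ (n m) ω₀)))
        atTop (fun _ => 0) ∧
      TendstoInMeasure P
        (fun m ω => ParamBoot.kolmogorovDist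
          ((ParamBoot.bootLaw (ParamBoot.observed Y (n m) ω)).map (ParamBoot.ATS H G))
          (P₀.map fun ω₀ => ParamBoot.ATS H G (ParamBoot.observed Y₀ (n m) ω₀)))
        atTop (fun _ => 0) := by

  have hVs : ∀ i, (V i).PosSemidef := fun i => (hV i).posSemidef
  have hS₀ := ParamBoot.posDef_limitCov hκ hV
  have hW := ParamBoot.isRegularWeight_waldWeight (H := H) hS₀
  simp only [ParamBoot.WTS_eq_quadStat, ParamBoot.ATS_eq_quadStat]
  refine ⟨?_, ?_⟩
  · rw [← ParamBoot.limitLaw_waldWeight hκ hV]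
    exact hW.tendstoWeaklyInProbability_bootLaw hY hVs hn hκ hnκ
  -- At rank zero the limit is a point mass, to which Pólya's theorem does not apply; but then `H =
  -- 0`, and both laws being compared are the point mass at `0`.
  rcases eq_or_ne H.rank 0 with h0 | h0
  · have hH0 : H = 0 := by
      obtain ⟨B, C, L, R, hBC, -, -⟩ := ParamBoot.exists_rank_factorization H
      have : IsEmpty (Fin H.rank) := by rw [h0]; infer_instance
      rw [hBC]
      ext i j
      simp [Matrix.mul_apply]
    have hzero : ∀ (K : Matrix (Σ i, Fin (t i)) (Σ i, Fin (t i)) ℝ →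
        Matrix (Σ i, Fin (t i)) (Σ i, Fin (t i)) ℝ), (∀ S, K S = 0) →
        TendstoInMeasure P (fun m ω => ParamBoot.kolmogorovDist
          ((ParamBoot.bootLaw (ParamBoot.observed Y (n m) ω)).map (ParamBoot.quadStat K))
          (P₀.map fun ω₀ => ParamBoot.quadStat K (ParamBoot.observed Y₀ (n m) ω₀)))
        atTop (fun _ => 0) := by
      intro K hK
      have hq : ∀ n : Fin a → ℕ, (ParamBoot.quadStat K : ParamBoot.Sample t n → ℝ) =
          fun _ => 0 := by
        intro n
        ext y
        simp [ParamBoot.quadStat, hK]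
      simp only [hq, ParamBoot.bootLaw_eq_normalSampleLaw, ParamBoot.kolmogorovDist_map_const]
      exact tendstoInMeasure_of_tendsto_ae (fun _ => aestronglyMeasurable_const)
        (ae_of_all _ fun _ => tendsto_const_nhds)
    exact ⟨hzero _ fun S => by simp [ParamBoot.waldWeight, hH0],
      hzero _ fun S => by simp [ParamBoot.anovaWeight, hH0]⟩
  · have htr := (ParamBoot.trace_projection_mul_pos h0 hG hS₀).ne'
    have hA := ParamBoot.isRegularWeight_anovaWeight htr
    constructor
    · have := ParamBoot.nullSingletonClass_limitLaw hκ hVs (K := ParamBoot.waldWeight H)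
        (by rw [ParamBoot.trace_waldWeight_mul hS₀]; exact_mod_cast h0)
      exact hW.tendstoInMeasure_kolmogorovDist hY hVs hn hκ hnκ hY₀ hμ₀
    · have := ParamBoot.nullSingletonClass_limitLaw hκ hVs (K := ParamBoot.anovaWeight H G)
        (by rw [ParamBoot.trace_anovaWeight_mul htr]; exact one_ne_zero)
      exact hA.tendstoInMeasure_kolmogorovDist hY hVs hn hκ hnκ hY₀ hμ₀
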